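/- Let $K$ be a perfect field of characteristic $2$, let $n\ge 1$ and $0\le j<n$ be integers, and let $i\ge 0$ be an integer. For a polynomial $p\in K[X]$ let $L_n^{p}$ be the $K$-algebra (the deformed preprojective algebra of type $L_n$) given by the quiver with vertices $0,1,\dots,n-1$, a loop $\epsilon$ at the vertex $0$, and arrows $a_s\colon s\to s+1$ and $\overline a_s\colon s+1\to s$ for $0\le s\le n-2$, subject to the relations $$a_s\overline a_s+\overline a_{s-1}a_{s-1}=0\ \ (1\le s\le n-2),\qquad \overline a_{n-2}a_{n-2}=0,\qquad \epsilon^{2n}=0,\qquad \epsilon^2+a_0\overline a_0+\epsilon^3p(\epsilon)=0,$$ where paths are composed from left to right (for $n=1$ there are no arrows $a_s,\overline a_s$, and the terms and relations containing them are omitted). For a $K$-algebra $A$ let $[A,A]$ be the $K$-linear span of all $ab-ba$ with $a,b\in A$, and let $T_i(A)=\{x\in A : x^{2^i}\in[A,A]\}$ be the $i$-th Külshammer space, which is a $K$-subspace of $A$. Then $L_n^{X^{2j}}$ is finite-dimensional over $K$ and $$\dim_K T_i\bigl(L_n^{X^{2j}}\bigr)-\dim_K\bigl[L_n^{X^{2j}},L_n^{X^{2j}}\bigr]=n-\max\left(\left\lceil\frac{2n-(2^{i+1}-2)j-(2^{i+1}-1)}{2^{i+1}}\right\rceil,\,0\right).$$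 -/

import Mathlib

/-! ### Commutator space and Külshammer spaces -/

/-- The commutator space `[A, A]`: the `K`-linear span of all `a * b - b * a`. -/
def commutatorSpace (K A : Type*) [Field K] [Ring A] [Algebra K A] : Submodule K A :=
  Submodule.span K {z : A | ∃ a b : A, z = a * b - b * a}

theorem commutator_mem_commutatorSpace (K : Type*) {A : Type*} [Field K] [Ring A] [Algebra K A]
    (a b : A) : a * b - b * a ∈ commutatorSpace K A :=
  Submodule.subset_span ⟨a, b, rfl⟩

theorem add_self_eq_zero_of_charTwo (K : Type*) {A : Type*} [Field K] [CharP K 2] [Ring A]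
    [Algebra K A] (x : A) : x + x = 0 := by
  have h : (2 : K) = 0 := CharTwo.two_eq_zero
  calc x + x = (2 : K) • x := (two_smul K x).symm
    _ = 0 := by rw [h, zero_smul]

/-- In characteristic two, `(x + y)² ≡ x² + y²` modulo `[A, A]`. -/
theorem add_sq_sub_mem_commutatorSpace (K : Type*) {A : Type*} [Field K] [CharP K 2] [Ring A]
    [Algebra K A] (x y : A) : (x + y) ^ 2 - (x ^ 2 + y ^ 2) ∈ commutatorSpace K A := by
  have h : (x + y) ^ 2 - (x ^ 2 + y ^ 2) = (x * y - y * x) + (y * x + y * x) := by noncomm_ring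
  rw [h, add_self_eq_zero_of_charTwo K, add_zero]
  exact commutator_mem_commutatorSpace K x y

/-- In characteristic two, `[A, A]` is closed under squaring. -/
theorem sq_mem_commutatorSpace {K A : Type*} [Field K] [CharP K 2] [Ring A]
    [Algebra K A] {x : A} (hx : x ∈ commutatorSpace K A) : x ^ 2 ∈ commutatorSpace K A := by
  induction hx using Submodule.span_induction with
  | mem x hx =>
    obtain ⟨a, b, rfl⟩ := hx
    have h : (a * b - b * a) ^ 2
        = (a * (b * a * b) - (b * a * b) * a) - (a * (b * b * a) - (b * b * a) * a)
          - (b * (a * a * b) - (a * a * b) * b)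
          + ((b * a * b * a + b * a * b * a) - (b * b * a * a + a * a * b * b)) := by
      noncomm_ring
    have h2 : b * b * a * a + a * a * b * b
        = (a * a * (b * b) - (b * b) * (a * a)) + (b * b * a * a + b * b * a * a) := by
      noncomm_ring
    rw [h, h2, add_self_eq_zero_of_charTwo K, add_self_eq_zero_of_charTwo K, add_zero, zero_sub]
    exact add_mem (sub_mem (sub_mem (commutator_mem_commutatorSpace K _ _)
      (commutator_mem_commutatorSpace K _ _)) (commutator_mem_commutatorSpace K _ _))
      (neg_mem (commutator_mem_commutatorSpace K _ _))
  | zero => simp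
  | add x y _ _ hx hy =>
    have h := add_mem (add_sq_sub_mem_commutatorSpace K x y) (add_mem hx hy)
    rwa [sub_add_cancel] at h
  | smul c x _ hx =>
    rw [smul_pow]
    exact Submodule.smul_mem _ _ hx

theorem add_pow_two_pow_sub_mem_commutatorSpace (K : Type*) {A : Type*} [Field K] [CharP K 2]
    [Ring A] [Algebra K A] (i : ℕ) (x y : A) :
    (x + y) ^ 2 ^ i - (x ^ 2 ^ i + y ^ 2 ^ i) ∈ commutatorSpace K A := by
  induction i with
  | zero => simp
  | succ i ih =>
    simp only [pow_succ 2 i, pow_mul]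
    set u := (x + y) ^ 2 ^ i
    set v := x ^ 2 ^ i
    set w := y ^ 2 ^ i
    have h1 := sq_mem_commutatorSpace ih
    have h2 := add_sq_sub_mem_commutatorSpace K (u - (v + w)) (v + w)
    have h3 := add_sq_sub_mem_commutatorSpace K v w
    rw [sub_add_cancel] at h2
    have h := add_mem (add_mem h2 h1) h3
    convert h using 1
    abel

/-- For an algebra `A` over a field `K` of characteristic two, the `i`-th Külshammer space
`T_i(A) = {x ∈ A | x ^ (2 ^ i) ∈ [A, A]}`, together with the fact that it is a `K`-subspace. -/
def kuelshammerSpace (K A : Type*) [Field K] [CharP K 2] [Ring A] [Algebra K A] (i : ℕ) :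
    Submodule K A where
  carrier := {x : A | x ^ 2 ^ i ∈ commutatorSpace K A}
  zero_mem' := by simp
  add_mem' := by
    intro x y hx hy
    have h := add_mem (add_pow_two_pow_sub_mem_commutatorSpace K i x y) (add_mem hx hy)
    rwa [sub_add_cancel] at h
  smul_mem' := by
    intro c x hx
    change (c • x) ^ 2 ^ i ∈ commutatorSpace K A
    rw [smul_pow]
    exact Submodule.smul_mem _ _ hx

/-! ### Path algebras of finite quivers -/

/-- The defining relations of the path algebra of a finite quiver with vertex set `V`, arrow set
`E`, source map `s` and target map `t`, on the generators `e_v` (`Sum.inl v`) and `α` (`Sum.inr α`).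
Paths are composed from left to right: `α * β` is the path "first `α`, then `β`". -/
inductive PathRel (K : Type*) [Field K] {V E : Type*} [Fintype V] (s t : E → V) :
    FreeAlgebra K (V ⊕ E) → FreeAlgebra K (V ⊕ E) → Prop
  | idem (v : V) : PathRel K s t
      (FreeAlgebra.ι K (Sum.inl v) * FreeAlgebra.ι K (Sum.inl v)) (FreeAlgebra.ι K (Sum.inl v))
  | orth (v w : V) (h : v ≠ w) : PathRel K s t
      (FreeAlgebra.ι K (Sum.inl v) * FreeAlgebra.ι K (Sum.inl w)) 0
  | sum_one : PathRel K s t (∑ v : V, FreeAlgebra.ι K (Sum.inl v)) 1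
  | source (α : E) : PathRel K s t
      (FreeAlgebra.ι K (Sum.inl (s α)) * FreeAlgebra.ι K (Sum.inr α)) (FreeAlgebra.ι K (Sum.inr α))
  | target (α : E) : PathRel K s t
      (FreeAlgebra.ι K (Sum.inr α) * FreeAlgebra.ι K (Sum.inl (t α))) (FreeAlgebra.ι K (Sum.inr α))

/-- The path algebra `KQ` of the finite quiver `Q = (V, E, s, t)`, presented by the trivial paths
`e_v` (orthogonal idempotents with sum `1`) and the arrows `α = e_{s α} α e_{t α}`. -/
def PathAlgebra (K : Type*) [Field K] {V E : Type*} [Fintype V] (s t : E → V) :=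
  RingQuot (PathRel K s t)

namespace PathAlgebra

noncomputable instance (K : Type*) [Field K] {V E : Type*} [Fintype V] (s t : E → V) :
    Ring (PathAlgebra K s t) :=
  inferInstanceAs (Ring (RingQuot (PathRel K s t)))

noncomputable instance (K : Type*) [Field K] {V E : Type*} [Fintype V] (s t : E → V) :
    Algebra K (PathAlgebra K s t) :=
  inferInstanceAs (Algebra K (RingQuot (PathRel K s t)))

/-- The element of the path algebra given by an arrow. -/
noncomputable def arrow (K : Type*) [Field K] {V E : Type*} [Fintype V] (s t : E → V) (α : E) :
    PathAlgebra K s t :=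
  RingQuot.mkAlgHom K (PathRel K s t) (FreeAlgebra.ι K (Sum.inr α))

end PathAlgebra

/-! ### The deformed preprojective algebras of type `L_n` -/

/-- The arrows of the quiver of type `L_n` on the vertices `0, …, n - 1`: a loop `ε` at `0`, and
arrows `a_i : i → i + 1` and `ā_i : i + 1 → i` for `0 ≤ i ≤ n - 2`. -/
inductive LArrow (n : ℕ)
  | eps : LArrow n
  | a (i : Fin (n - 1)) : LArrow n
  | abar (i : Fin (n - 1)) : LArrow n

namespace LArrow

/-- The source of an arrow. -/
def source {n : ℕ} [NeZero n] : LArrow n → Fin n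
  | eps => 0
  | a i => ⟨(i : ℕ), by omega⟩
  | abar i => ⟨(i : ℕ) + 1, by omega⟩

/-- The target of an arrow. -/
def target {n : ℕ} [NeZero n] : LArrow n → Fin n
  | eps => 0
  | a i => ⟨(i : ℕ) + 1, by omega⟩
  | abar i => ⟨(i : ℕ), by omega⟩

end LArrow

/-- The path algebra of the quiver of type `L_n`. -/
abbrev LPathAlgebra (K : Type*) [Field K] (n : ℕ) [NeZero n] :=
  PathAlgebra K (LArrow.source (n := n)) (LArrow.target (n := n))

namespace LPathAlgebra

/-- The loop `ε` at the vertex `0`. -/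
noncomputable def eps (K : Type*) [Field K] (n : ℕ) [NeZero n] : LPathAlgebra K n :=
  PathAlgebra.arrow K _ _ LArrow.eps

/-- The arrow `a_i : i → i + 1`. -/
noncomputable def a (K : Type*) [Field K] (n : ℕ) [NeZero n] (i : Fin (n - 1)) :
    LPathAlgebra K n :=
  PathAlgebra.arrow K _ _ (LArrow.a i)

/-- The arrow `ā_i : i + 1 → i`. -/
noncomputable def abar (K : Type*) [Field K] (n : ℕ) [NeZero n] (i : Fin (n - 1)) :
    LPathAlgebra K n :=
  PathAlgebra.arrow K _ _ (LArrow.abar i)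

end LPathAlgebra

open LPathAlgebra in
/-- The relations defining `L_n^p`. If `n = 1` the arrows `a_i`, `ā_i` do not exist and the
terms containing them are absent. -/
inductive DeformedRel (K : Type*) [Field K] (n : ℕ) [NeZero n] (p : Polynomial K) :
    LPathAlgebra K n → LPathAlgebra K n → Prop
  | mesh (i : ℕ) (h : i + 1 < n - 1) : DeformedRel K n p
      (a K n ⟨i + 1, h⟩ * abar K n ⟨i + 1, h⟩
        + abar K n ⟨i, by omega⟩ * a K n ⟨i, by omega⟩) 0
  | last (h : 1 < n) : DeformedRel K n p
      (abar K n ⟨n - 2, by omega⟩ * a K n ⟨n - 2, by omega⟩) 0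
  | eps_pow : DeformedRel K n p (eps K n ^ (2 * n)) 0
  | deformed (h : 1 < n) : DeformedRel K n p
      (eps K n ^ 2 + a K n ⟨0, by omega⟩ * abar K n ⟨0, by omega⟩
        + eps K n ^ 3 * Polynomial.aeval (eps K n) p) 0
  | deformed_one (h : n = 1) : DeformedRel K n p
      (eps K n ^ 2 + eps K n ^ 3 * Polynomial.aeval (eps K n) p) 0

/-- The deformed preprojective algebra `L_n^p` of type `L_n` with deformation polynomial `p`. -/
def DeformedPreprojectiveL (K : Type*) [Field K] (n : ℕ) [NeZero n] (p : Polynomial K) :=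
  RingQuot (DeformedRel K n p)

noncomputable instance (K : Type*) [Field K] (n : ℕ) [NeZero n] (p : Polynomial K) :
    Ring (DeformedPreprojectiveL K n p) :=
  inferInstanceAs (Ring (RingQuot (DeformedRel K n p)))

noncomputable instance (K : Type*) [Field K] (n : ℕ) [NeZero n] (p : Polynomial K) :
    Algebra K (DeformedPreprojectiveL K n p) :=
  inferInstanceAs (Algebra K (RingQuot (DeformedRel K n p)))

/-! ### Polynomials modulo the subalgebra generated by `X ^ 2 + X ^ 3 * X ^ (2 * j)` -/

/-! Write A for the algebra, u = X² + X^(2j+3), so that a₀ā₀ = u(ε) in characteristic two, and V_N =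
K[u] + X^N K[X], which is `adjoinModPow K j N`. The proof computes A/[A,A] and then follows the
2^i-th power map on it.

Upper bound for A/[A,A]. With a and b the sums of the arrows a_s and ā_s, the mesh relations
together say ab = ba + u(ε), with aε = 0 = εb. Rewriting and cyclic rotation reduce every element
modulo [A,A] to ∑ c_s e_s + f(ε) with f(0) = 0. Moreover u(ε)^k = (ab)^k - (ba)^k is a commutator
for k ≥ 1, so f(ε) lies in [A,A] when f is in V_{2n} (`LRelations.aeval_mem_commutatorSpace`).

Lower bound. Sending ε to X E₀₀, a_s to E_{s,s+1} and ā_s to u E_{s+1,s} represents the path algebra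
by matrices over K[X]. Not all relations hold there, but the matrix trace modulo V_{2n} kills the
ideal they generate (`LPathAlgebra.modelTrace_rel`). Hence f(ε) is in [A,A] exactly when f is in
V_{2n} (`DeformedPreprojectiveL.aeval_loop_mem_iff`), and the simple modules detect the c_s.

Powers. The simple modules kill T_i(A), so T_i(A)/[A,A] consists of the classes of f(ε) with f^(2^i)
in V_{2n}. The filtration V_N drops only from odd N to N + 1, by the class of X^N. For odd N the
power u^N begins X^(2N) + X^(2N+2j+1), so squaring sends a leading term cX^N to c²X^(2N+2j+1). After
i squarings the order is 2^i N + (2^i - 1)(2j+1). Thus f^(2^i) is in V_{2n} if and only if f is in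
V_{2m}, where m is the least natural number for which N = 2m + 1 reaches order at least 2n
(`adjoinModPow.pow_two_pow_mem_iff`). Since V_{2m}/V_{2n} has dimension n - m, the formula follows.
-/

open Polynomial in
/-- The polynomial `X ^ 2 + X ^ 3 * X ^ (2 * j)`. -/
noncomputable def deformationPoly (K : Type*) [Field K] (j : ℕ) : K[X] :=
  X ^ 2 + X ^ 3 * X ^ (2 * j)

open Polynomial in
/-- The polynomials congruent modulo `X ^ N` to a polynomial in `deformationPoly K j`. -/
noncomputable def adjoinModPow (K : Type*) [Field K] (j N : ℕ) : Submodule K K[X] :=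
  LinearMap.range (aeval (R := K) (deformationPoly K j)).toLinearMap ⊔
    (Ideal.span {(X : K[X]) ^ N}).restrictScalars K

namespace adjoinModPow

open Polynomial

variable {K : Type*} [Field K] {j : ℕ}

theorem mem_iff {N : ℕ} {f : K[X]} :
    f ∈ adjoinModPow K j N ↔ ∃ g r : K[X], f = aeval (deformationPoly K j) g + X ^ N * r := by
  simp only [adjoinModPow, Submodule.mem_sup, LinearMap.mem_range, AlgHom.toLinearMap_apply,
    Submodule.restrictScalars_mem, Ideal.mem_span_singleton']
  constructor
  · rintro ⟨_, ⟨g, rfl⟩, _, ⟨r, rfl⟩, rfl⟩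
    exact ⟨g, r, by rw [mul_comm r]⟩
  · rintro ⟨g, r, rfl⟩
    exact ⟨_, ⟨g, rfl⟩, _, ⟨r, mul_comm _ _⟩, rfl⟩

theorem aeval_mem (N : ℕ) (g : K[X]) : aeval (deformationPoly K j) g ∈ adjoinModPow K j N :=
  mem_iff.2 ⟨g, 0, by simp⟩

theorem pow_mem (N k : ℕ) : deformationPoly K j ^ k ∈ adjoinModPow K j N := by
  simpa using aeval_mem (j := j) N ((X : K[X]) ^ k)

theorem X_pow_mul_mem {N M : ℕ} (h : N ≤ M) (r : K[X]) : X ^ M * r ∈ adjoinModPow K j N :=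
  mem_iff.2 ⟨0, X ^ (M - N) * r, by rw [map_zero, zero_add, ← mul_assoc, ← pow_add,
    Nat.add_sub_cancel' h]⟩

theorem anti {N M : ℕ} (h : N ≤ M) : adjoinModPow K j M ≤ adjoinModPow K j N := by
  intro f hf
  obtain ⟨g, r, rfl⟩ := mem_iff.1 hf
  exact add_mem (aeval_mem N g) (X_pow_mul_mem h r)

theorem zero_eq_top : adjoinModPow K j 0 = ⊤ :=
  eq_top_iff.2 fun f _ => by
    simpa using X_pow_mul_mem (j := j) (Nat.zero_le 0) f

/-- Since u = X²(1 + X^(2j+1)), this is the binomial expansion to first order. The second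
coefficient k matters through its parity. -/
theorem exists_deformationPoly_pow_eq (k : ℕ) :
    ∃ r : K[X], deformationPoly K j ^ k
      = X ^ (2 * k) + C (k : K) * X ^ (2 * k + (2 * j + 1))
        + X ^ (2 * k + (2 * j + 1) + 1) * r := by
  induction k with
  | zero => exact ⟨0, by simp⟩
  | succ k ih =>
    obtain ⟨r, hr⟩ := ih
    refine ⟨C (k : K) * X ^ (2 * j) + r * (1 + X ^ (2 * j + 1)), ?_⟩
    rw [pow_succ, hr, deformationPoly]
    push_cast
    simp only [map_add, map_one, map_natCast]
    ring

theorem X_pow_two_mul_add_mem (k : ℕ) :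
    X ^ (2 * k) + C (k : K) * X ^ (2 * k + (2 * j + 1)) ∈
      adjoinModPow K j (2 * k + (2 * j + 1) + 1) := by
  obtain ⟨r, hr⟩ := exists_deformationPoly_pow_eq (K := K) (j := j) k
  rw [← sub_eq_iff_eq_add.2 hr]
  exact sub_mem (pow_mem _ _) (X_pow_mul_mem le_rfl _)

theorem X_pow_two_mul_mem (k : ℕ) :
    (X : K[X]) ^ (2 * k) ∈ adjoinModPow K j (2 * k + (2 * j + 1)) := by
  have h := sub_mem (anti (Nat.le_succ _) (X_pow_two_mul_add_mem (K := K) (j := j) k))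
    (X_pow_mul_mem le_rfl (C (k : K)))
  rwa [mul_comm (X ^ _) (C _), add_sub_cancel_right] at h

theorem exists_sub_mem_succ {N : ℕ} {f : K[X]} (hf : f ∈ adjoinModPow K j N) :
    ∃ c : K, f - C c * X ^ N ∈ adjoinModPow K j (N + 1) := by
  obtain ⟨g, r, rfl⟩ := mem_iff.1 hf
  refine ⟨r.coeff 0, mem_iff.2 ⟨g, r.divX, ?_⟩⟩
  conv_lhs => rw [← X_mul_divX_add r]
  simp only [coeff_add, coeff_C_zero, mul_coeff_zero, coeff_X_zero, zero_mul, zero_add]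
  ring

/-- An even power X^(2k) is the leading term of u^k, so it can be traded for terms of higher order.
-/
theorem two_mul_eq_succ (k : ℕ) : adjoinModPow K j (2 * k) = adjoinModPow K j (2 * k + 1) := by
  refine le_antisymm (fun f hf => ?_) (anti (Nat.le_succ _))
  obtain ⟨c, hc⟩ := exists_sub_mem_succ hf
  have h := (adjoinModPow K j (2 * k + 1)).smul_mem c
    (anti (by omega) (X_pow_two_mul_mem (K := K) (j := j) k))
  rw [smul_eq_C_mul] at h
  simpa using add_mem hc h

theorem exists_sub_mem_two_mul {k : ℕ} {f : K[X]} (hf : f ∈ adjoinModPow K j (2 * k)) :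
    ∃ c : K, f - C c * X ^ (2 * k + 1) ∈ adjoinModPow K j (2 * (k + 1)) :=
  exists_sub_mem_succ (N := 2 * k + 1) (two_mul_eq_succ (K := K) (j := j) k ▸ hf)

/-- Since u has order 2, a nonzero g(u) has even order 2k, where k is the order of g at 0. It cannot
agree with a series whose leading term has odd order N; cancelling the smaller power of X makes a
nonzero constant coefficient vanish. -/
theorem eq_zero_of_C_mul_X_pow_mem {N : ℕ} (hN : Odd N) {c : K}
    (h : C c * X ^ N ∈ adjoinModPow K j (N + 1)) : c = 0 := by
  obtain ⟨g, r, hg⟩ := mem_iff.1 h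
  by_contra hc
  have hu : deformationPoly K j = X ^ 2 * (1 + X * X ^ (2 * j)) := by
    rw [deformationPoly]; ring
  have key : aeval (deformationPoly K j) g = X ^ N * (C c - X * r) := by
    rw [← sub_eq_iff_eq_add.2 hg]; ring
  have hg0 : g ≠ 0 := by
    rintro rfl
    rw [map_zero, eq_comm, mul_eq_zero] at key
    rcases key with h0 | h0
    · exact pow_ne_zero _ X_ne_zero h0
    · simpa [hc] using congrArg (coeff · 0) h0
  obtain ⟨k, g', hg', hgX⟩ : ∃ k g', g = X ^ k * g' ∧ ¬ X ∣ g' := by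
    obtain ⟨g', h1, h2⟩ := exists_eq_pow_rootMultiplicity_mul_and_not_dvd g hg0 0
    rw [map_zero, sub_zero] at h1 h2
    exact ⟨_, g', h1, h2⟩
  rw [X_dvd_iff] at hgX
  set h := (1 + X * X ^ (2 * j)) ^ k * aeval (deformationPoly K j) g' with hh
  have h0 : h.coeff 0 ≠ 0 := by
    have : h.coeff 0 = g'.coeff 0 := by
      rw [hh, mul_coeff_zero, coeff_zero_eq_eval_zero (aeval _ g'), ← comp_eq_aeval, eval_comp, hu,
        coeff_zero_eq_eval_zero, coeff_zero_eq_eval_zero]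
      simp
    rwa [this]
  have key' : X ^ (2 * k) * h = X ^ N * (C c - X * r) := by
    rw [← key, hg', map_mul, map_pow, aeval_X, hh]
    conv_rhs => rw [hu, mul_pow, ← pow_mul]
    rw [← hu]; ring
  have hc' : (C c - X * r).coeff 0 ≠ 0 := by simpa using hc
  have hne : 2 * k ≠ N := by rintro rfl; exact (Nat.not_odd_iff_even.2 (even_two_mul k)) hN
  rcases lt_or_gt_of_ne hne with hlt | hlt
  · obtain ⟨d, rfl⟩ := Nat.exists_eq_add_of_lt hlt
    rw [add_assoc, pow_add, mul_assoc] at key'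
    have := mul_left_cancel₀ (pow_ne_zero _ X_ne_zero) key'
    exact h0 (by rw [this]; simp [mul_coeff_zero])
  · obtain ⟨d, hd⟩ := Nat.exists_eq_add_of_lt hlt
    rw [hd, add_assoc, pow_add, mul_assoc] at key'
    have := mul_left_cancel₀ (pow_ne_zero _ X_ne_zero) key'
    exact hc' (by rw [← this]; simp [mul_coeff_zero])

/-! ### Squaring and the filtration by order -/

section CharTwo

variable [CharP K 2]

/-- In characteristic two r² contains only even powers of X, and modulo K[u] each of them gains
order 2j + 1. -/
theorem X_pow_mul_sq_mem (k : ℕ) (r : K[X]) :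
    X ^ (2 * k) * r ^ 2 ∈ adjoinModPow K j (2 * k + (2 * j + 1)) := by
  induction r using Polynomial.induction_on' with
  | add p q hp hq => rw [CharTwo.add_sq, mul_add]; exact add_mem hp hq
  | monomial l c =>
    have h := (adjoinModPow K j (2 * k + (2 * j + 1))).smul_mem (c ^ 2)
      (anti (by omega) (X_pow_two_mul_mem (K := K) (j := j) (k + l)))
    convert h using 1
    rw [← C_mul_X_pow_eq_monomial, smul_eq_C_mul, C_pow]
    ring

/-- Write f = cX^N + g(u) + X^(N+1) r and square termwise. The square of g(u) stays in K[u], and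
that of the remainder has high enough order. As N is odd, N = 1 in K, so the second term of u^N
survives and X^(2N) is congruent to X^(2N+2j+1). -/
theorem sq_sub_mem {N : ℕ} (hN : Odd N) {f : K[X]} {c : K}
    (h : f - C c * X ^ N ∈ adjoinModPow K j (N + 1)) :
    f ^ 2 - C (c ^ 2) * X ^ (2 * N + (2 * j + 1)) ∈
      adjoinModPow K j (2 * N + (2 * j + 1) + 1) := by
  obtain ⟨g, r, hg⟩ := mem_iff.1 h
  have hN1 : (N : K) = 1 := by
    obtain ⟨k, rfl⟩ := hN
    push_cast
    rw [CharTwo.two_eq_zero]; ring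
  have h1 := X_pow_two_mul_add_mem (K := K) (j := j) N
  rw [hN1] at h1
  have h1 := (adjoinModPow K j (2 * N + (2 * j + 1) + 1)).smul_mem (c ^ 2) h1
  have h2 : X ^ (2 * (N + 1)) * r ^ 2 ∈ adjoinModPow K j (2 * N + (2 * j + 1) + 1) :=
    anti (by omega) (X_pow_mul_sq_mem (N + 1) r)
  have h3 := aeval_mem (j := j) (2 * N + (2 * j + 1) + 1) (g ^ 2)
  convert add_mem (add_mem h1 h2) h3 using 1
  rw [sub_eq_iff_eq_add.1 hg, CharTwo.add_sq, CharTwo.add_sq, smul_eq_C_mul,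
    CharTwo.sub_eq_add, map_pow, map_pow, C_1]
  ring

/-- The odd order reached by the `2 ^ i`-th power of a polynomial of odd order `N`. -/
theorem pow_two_pow_sub_mem {N : ℕ} (hN : Odd N) {f : K[X]} {c : K}
    (h : f - C c * X ^ N ∈ adjoinModPow K j (N + 1)) (i : ℕ) :
    f ^ 2 ^ i - C (c ^ 2 ^ i) * X ^ (2 ^ i * N + (2 ^ i - 1) * (2 * j + 1)) ∈
      adjoinModPow K j (2 ^ i * N + (2 ^ i - 1) * (2 * j + 1) + 1) ∧
    Odd (2 ^ i * N + (2 ^ i - 1) * (2 * j + 1)) := by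
  induction i with
  | zero => simpa using ⟨h, hN⟩
  | succ i ih =>
    -- The exponent is the i-fold iterate of N ↦ 2N + (2j+1), which also preserves oddness.
    have e : 2 ^ (i + 1) * N + (2 ^ (i + 1) - 1) * (2 * j + 1)
        = 2 * (2 ^ i * N + (2 ^ i - 1) * (2 * j + 1)) + (2 * j + 1) := by
      obtain ⟨t, ht⟩ := Nat.exists_eq_add_of_le' (Nat.one_le_two_pow (n := i))
      rw [pow_succ, ht, show (t + 1) * 2 - 1 = 2 * t + 1 by omega, Nat.add_sub_cancel]
      ring
    rw [e]
    refine ⟨?_, (even_two_mul _).add_odd (odd_two_mul_add_one j)⟩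
    have := sq_sub_mem ih.2 ih.1
    rwa [← pow_mul, ← pow_mul, ← pow_succ] at this

theorem pow_two_pow_mem_iff {n m i : ℕ}
    (hm : 2 * n ≤ 2 ^ i * (2 * m + 1) + (2 ^ i - 1) * (2 * j + 1))
    (hlt : ∀ k < m, 2 ^ i * (2 * k + 1) + (2 ^ i - 1) * (2 * j + 1) < 2 * n) (f : K[X]) :
    f ^ 2 ^ i ∈ adjoinModPow K j (2 * n) ↔ f ∈ adjoinModPow K j (2 * m) := by
  constructor
  · intro hf
    -- Climb the filtration: for k < m, a leading term cX^(2k+1) of f would leave c^(2^i) at an odd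
    -- order below 2n in f^(2^i), forcing c = 0.
    suffices ∀ k ≤ m, f ∈ adjoinModPow K j (2 * k) from this m le_rfl
    intro k hk
    induction k with
    | zero => rw [mul_zero, zero_eq_top]; trivial
    | succ k ih =>
      obtain ⟨c, hc⟩ := exists_sub_mem_two_mul (ih (by omega))
      obtain ⟨h1, h2⟩ := pow_two_pow_sub_mem (odd_two_mul_add_one k) hc i
      have h3 := sub_mem (anti (hlt k hk) hf) h1
      rw [sub_sub_cancel] at h3
      have h4 := eq_zero_of_C_mul_X_pow_mem h2 h3
      rw [pow_eq_zero_iff (by positivity)] at h4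
      simpa [h4] using hc
  · intro hf
    obtain ⟨c, hc⟩ := exists_sub_mem_two_mul hf
    have h1 := (pow_two_pow_sub_mem (odd_two_mul_add_one m) hc i).1
    have h2 := X_pow_mul_mem (j := j) hm (C (c ^ 2 ^ i))
    rw [mul_comm (X ^ _) (C _)] at h2
    have h3 := add_mem (anti (by omega : 2 * n ≤ _) h1) h2
    rwa [sub_add_cancel] at h3

end CharTwo

/-! ### Dimensions of the filtration quotients -/

theorem two_mul_eq_sup (k : ℕ) :
    adjoinModPow K j (2 * k) = adjoinModPow K j (2 * (k + 1)) ⊔ K ∙ (X : K[X]) ^ (2 * k + 1) := by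
  apply le_antisymm
  · intro f hf
    obtain ⟨c, hc⟩ := exists_sub_mem_two_mul hf
    refine Submodule.mem_sup.2 ⟨_, hc, C c * X ^ (2 * k + 1), ?_, by ring⟩
    exact Submodule.mem_span_singleton.2 ⟨c, smul_eq_C_mul _⟩
  · rw [sup_le_iff, Submodule.span_singleton_le_iff_mem]
    refine ⟨anti (by omega), ?_⟩
    simpa using X_pow_mul_mem (j := j) (by omega : 2 * k ≤ 2 * k + 1) (1 : K[X])

theorem X_pow_notMem (k : ℕ) : (X : K[X]) ^ (2 * k + 1) ∉ adjoinModPow K j (2 * (k + 1)) :=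
  fun h => one_ne_zero (α := K)
    (eq_zero_of_C_mul_X_pow_mem (odd_two_mul_add_one k) (by rwa [C_1, one_mul]))

theorem map_mkQ_two_mul (n k : ℕ) :
    (adjoinModPow K j (2 * k)).map (adjoinModPow K j (2 * n)).mkQ =
      (adjoinModPow K j (2 * (k + 1))).map (adjoinModPow K j (2 * n)).mkQ ⊔
        K ∙ (adjoinModPow K j (2 * n)).mkQ (X ^ (2 * k + 1)) := by
  conv_lhs => rw [two_mul_eq_sup k, Submodule.map_sup, Submodule.map_span, Set.image_singleton]

theorem map_mkQ_self (N : ℕ) : (adjoinModPow K j N).map (adjoinModPow K j N).mkQ = ⊥ := by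
  rw [← le_bot_iff, Submodule.map_le_iff_le_comap, ← LinearMap.ker, Submodule.ker_mkQ]

theorem finite_map_mkQ (n d : ℕ) (hd : d ≤ n) :
    Module.Finite K
      ((adjoinModPow K j (2 * (n - d))).map (adjoinModPow K j (2 * n)).mkQ) := by
  induction d with
  | zero => rw [Nat.sub_zero, map_mkQ_self]; infer_instance
  | succ d ih =>
    have h1 := ih (by omega)
    rw [show n - d = n - (d + 1) + 1 by omega] at h1
    rw [map_mkQ_two_mul]
    infer_instance

instance finite_quotient (n : ℕ) : Module.Finite K (K[X] ⧸ adjoinModPow K j (2 * n)) := by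
  have h := finite_map_mkQ (K := K) (j := j) n n le_rfl
  rw [Nat.sub_self, mul_zero, zero_eq_top, Submodule.map_top, Submodule.range_mkQ] at h
  exact Module.Finite.equiv Submodule.topEquiv

/-- Passing from V_{2k+2} to V_{2k} adds exactly the class of X^(2k+1). Indexing by d = n - k lets
the induction start at the zero space. -/
theorem finrank_map_mkQ (n d : ℕ) (hd : d ≤ n) :
    Module.finrank K
      ((adjoinModPow K j (2 * (n - d))).map (adjoinModPow K j (2 * n)).mkQ) = d := by
  induction d with
  | zero => rw [Nat.sub_zero, map_mkQ_self]; exact finrank_bot K _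
  | succ d ih =>
    have h2 := ih (by omega)
    rw [show n - d = n - (d + 1) + 1 by omega] at h2
    rw [map_mkQ_two_mul, Submodule.finrank_sup_span_singleton, h2]
    intro h
    rw [← Submodule.mem_comap, Submodule.comap_map_mkQ,
      sup_eq_right.2 (anti (by omega))] at h
    exact X_pow_notMem _ h

end adjoinModPow

/-! ### Algebras presented like `L_n` -/

/-- Elements `e s` (`s : ℕ`, zero for `n ≤ s`), `a`, `b`, `ε` of a `K`-algebra satisfying the
relations of the deformed preprojective algebra of type `L_n`, where `a` and `b` are the sums of the
arrows `a_s` and `ā_s`, and `q` is the polynomial with `a_0 ā_0 = q(ε)`. -/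
structure LRelations (K : Type*) {A : Type*} [Field K] [Ring A] [Algebra K A] (n : ℕ)
    (q : Polynomial K) (e : ℕ → A) (a b ε : A) : Prop where
  idem : ∀ s, e s * e s = e s
  orth : ∀ s t, s ≠ t → e s * e t = 0
  e_eq_zero : ∀ s, n ≤ s → e s = 0
  sum_e : ∑ s ∈ Finset.range n, e s = 1
  e_mul_a : ∀ s, e s * a = a * e (s + 1)
  a_mul_e_zero : a * e 0 = 0
  e_succ_mul_b : ∀ s, e (s + 1) * b = b * e s
  e_zero_mul_b : e 0 * b = 0
  e_zero_mul_eps : e 0 * ε = ε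
  eps_mul_e_zero : ε * e 0 = ε
  a_mul_b : a * b = b * a + Polynomial.aeval ε q
  eps_pow : ε ^ (2 * n) = 0
  X_dvd : Polynomial.X ∣ q

namespace LRelations

open Polynomial

variable {K A : Type*} [Field K] [Ring A] [Algebra K A] {n : ℕ} {q : K[X]} {e : ℕ → A} {a b ε : A}

/-! ### Commutation rules for a, b, ε and the idempotents -/

section

variable (h : LRelations K n q e a b ε)
include h

theorem eps_mul_b : ε * b = 0 := by
  rw [← h.eps_mul_e_zero, mul_assoc, h.e_zero_mul_b, mul_zero]

theorem a_mul_eps : a * ε = 0 := by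
  rw [← h.e_zero_mul_eps, ← mul_assoc, h.a_mul_e_zero, zero_mul]

theorem aeval_mul_b {f : K[X]} (hf : X ∣ f) : aeval ε f * b = 0 := by
  obtain ⟨g, rfl⟩ := hf
  rw [mul_comm X g, map_mul, aeval_X, mul_assoc, h.eps_mul_b, mul_zero]

theorem a_mul_aeval {f : K[X]} (hf : X ∣ f) : a * aeval ε f = 0 := by
  obtain ⟨g, rfl⟩ := hf
  rw [map_mul, aeval_X, ← mul_assoc, h.a_mul_eps, zero_mul]

/-- Moving b to the left past each a produces a term a^k q(ε) a^(i-k). Because aε = 0, only the one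
with k = 0 survives. -/
theorem a_pow_succ_mul_b (i : ℕ) : a ^ (i + 1) * b = b * a ^ (i + 1) + aeval ε q * a ^ i := by
  induction i with
  | zero => simpa using h.a_mul_b
  | succ i ih =>
    rw [pow_succ a (i + 1), mul_assoc, h.a_mul_b, mul_add, pow_succ a i,
      mul_assoc (a ^ i) a (aeval ε q),
      h.a_mul_aeval h.X_dvd, mul_zero, add_zero, ← pow_succ, ← mul_assoc, ih]
    noncomm_ring

theorem a_mul_b_pow_succ (i : ℕ) : a * b ^ (i + 1) = b ^ (i + 1) * a + b ^ i * aeval ε q := by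
  induction i with
  | zero => simpa using h.a_mul_b
  | succ i ih =>
    rw [pow_succ b (i + 1), ← mul_assoc, ih, add_mul, mul_assoc _ (aeval ε q) b,
      h.aeval_mul_b h.X_dvd, mul_zero, add_zero, mul_assoc, h.a_mul_b]
    noncomm_ring

theorem e_mul_a_pow (s i : ℕ) : e s * a ^ i = a ^ i * e (s + i) := by
  induction i generalizing s with
  | zero => simp
  | succ i ih =>
    rw [pow_succ', ← mul_assoc, h.e_mul_a, mul_assoc, ih, ← mul_assoc,
      show s + 1 + i = s + (i + 1) by omega]

theorem a_pow_mul_e_of_lt {s i : ℕ} (hs : s < i) : a ^ i * e s = 0 := by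
  obtain ⟨d, rfl⟩ := Nat.exists_eq_add_of_lt hs
  have h1 := h.e_mul_a_pow 0 s
  rw [zero_add] at h1
  rw [show s + d + 1 = d + 1 + s by omega, pow_add, mul_assoc, ← h1, ← mul_assoc, pow_succ,
    mul_assoc (a ^ d), h.a_mul_e_zero, mul_zero, zero_mul]

theorem e_mul_b_pow (s i : ℕ) : e (s + i) * b ^ i = b ^ i * e s := by
  induction i generalizing s with
  | zero => simp
  | succ i ih =>
    rw [pow_succ', ← mul_assoc, ← add_assoc, h.e_succ_mul_b, mul_assoc, ih, ← mul_assoc]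

theorem e_mul_b_pow_of_lt {s i : ℕ} (hs : s < i) : e s * b ^ i = 0 := by
  obtain ⟨d, rfl⟩ := Nat.exists_eq_add_of_lt hs
  have h1 := h.e_mul_b_pow 0 s
  rw [zero_add] at h1
  rw [show s + d + 1 = s + (d + 1) by omega, pow_add, ← mul_assoc, h1, mul_assoc, pow_succ',
    ← mul_assoc (e 0), h.e_zero_mul_b, zero_mul, mul_zero]

theorem a_pow_eq_zero {i : ℕ} (hi : n ≤ i) : a ^ i = 0 := by
  rw [← one_mul (a ^ i), ← h.sum_e, Finset.sum_mul]
  refine Finset.sum_eq_zero fun s _ => ?_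
  rw [h.e_mul_a_pow, h.e_eq_zero _ (by omega), mul_zero]

theorem b_pow_eq_zero {i : ℕ} (hi : n ≤ i) : b ^ i = 0 := by
  rw [← mul_one (b ^ i), ← h.sum_e, Finset.mul_sum]
  refine Finset.sum_eq_zero fun s _ => ?_
  rw [← h.e_mul_b_pow, h.e_eq_zero _ (by omega), zero_mul]

theorem eps_mul_e {s : ℕ} (hs : s ≠ 0) : ε * e s = 0 := by
  rw [← h.eps_mul_e_zero, mul_assoc, h.orth _ _ hs.symm, mul_zero]

theorem aeval_mul_e_zero {f : K[X]} (hf : X ∣ f) : aeval ε f * e 0 = aeval ε f := by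
  obtain ⟨g, rfl⟩ := hf
  rw [mul_comm X g, map_mul, aeval_X, mul_assoc, h.eps_mul_e_zero]

theorem aeval_mul_e {f : K[X]} (hf : X ∣ f) {s : ℕ} (hs : s ≠ 0) : aeval ε f * e s = 0 := by
  obtain ⟨g, rfl⟩ := hf
  rw [mul_comm X g, map_mul, aeval_X, mul_assoc, h.eps_mul_e hs, mul_zero]

end

/-- The span of the monomials `e_s b^i ε^k a^l`. -/
def monomialSpan (K : Type*) {A : Type*} [Field K] [Ring A] [Algebra K A] (e : ℕ → A)
    (a b ε : A) : Submodule K A :=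
  Submodule.span K (Set.range fun x : ℕ × ℕ × ℕ × ℕ =>
    e x.1 * b ^ x.2.1 * ε ^ x.2.2.1 * a ^ x.2.2.2)

theorem monomial_mem (s i k l : ℕ) :
    e s * b ^ i * ε ^ k * a ^ l ∈ monomialSpan K e a b ε :=
  Submodule.subset_span ⟨(s, i, k, l), rfl⟩

theorem aeval_mem_monomialSpan (s i l : ℕ) (f : K[X]) :
    e s * b ^ i * aeval ε f * a ^ l ∈ monomialSpan K e a b ε := by
  induction f using Polynomial.induction_on' with
  | add f g hf hg => rw [map_add, mul_add, add_mul]; exact add_mem hf hg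
  | monomial k c =>
    rw [aeval_monomial, ← Algebra.smul_def, mul_smul_comm, smul_mul_assoc]
    exact Submodule.smul_mem _ _ (monomial_mem s i k l)

theorem monomialSpan_mul_mem {y : A} (hy : ∀ s i k l,
    e s * b ^ i * ε ^ k * a ^ l * y ∈ monomialSpan K e a b ε) {x : A}
    (hx : x ∈ monomialSpan K e a b ε) : x * y ∈ monomialSpan K e a b ε := by
  induction hx using Submodule.span_induction with
  | mem x hx => obtain ⟨x, rfl⟩ := hx; exact hy _ _ _ _
  | zero => simp
  | add x z _ _ hx hz => rw [add_mul]; exact add_mem hx hz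
  | smul c x _ hx => rw [smul_mul_assoc]; exact Submodule.smul_mem _ _ hx

theorem mul_a_mem {x : A} (hx : x ∈ monomialSpan K e a b ε) :
    x * a ∈ monomialSpan K e a b ε :=
  monomialSpan_mul_mem (fun s i k l => by
    rw [mul_assoc, ← pow_succ]; exact monomial_mem _ _ _ _) hx

/-! ### The monomials e_s b^i ε^k a^l span -/

section

variable (h : LRelations K n q e a b ε)
include h

theorem finite_monomialSpan : Module.Finite K (monomialSpan K e a b ε) := by
  let S : Finset (ℕ × ℕ × ℕ × ℕ) :=
    Finset.range n ×ˢ Finset.range n ×ˢ Finset.range (2 * n) ×ˢ Finset.range n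
  apply FiniteDimensional.span_of_finite
  refine ((S.finite_toSet.image fun x : ℕ × ℕ × ℕ × ℕ =>
    e x.1 * b ^ x.2.1 * ε ^ x.2.2.1 * a ^ x.2.2.2).union (Set.finite_singleton 0)).subset ?_
  rintro _ ⟨⟨s, i, k, l⟩, rfl⟩
  by_cases hS : (s, i, k, l) ∈ S
  · exact Or.inl ⟨_, hS, rfl⟩
  · refine Or.inr ?_
    simp only [S, Finset.mem_product, Finset.mem_range, not_and_or, not_lt] at hS
    change e s * b ^ i * ε ^ k * a ^ l = 0
    rcases hS with hS | hS | hS | hS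
    · rw [h.e_eq_zero _ hS, zero_mul, zero_mul, zero_mul]
    · rw [h.b_pow_eq_zero hS, mul_zero, zero_mul, zero_mul]
    · rw [pow_eq_zero_of_le hS h.eps_pow, mul_zero, zero_mul]
    · rw [h.a_pow_eq_zero hS, mul_zero]

theorem one_mem_monomialSpan : (1 : A) ∈ monomialSpan K e a b ε := by
  rw [← h.sum_e]
  refine sum_mem fun s _ => ?_
  simpa using monomial_mem (K := K) (e := e) (a := a) (b := b) (ε := ε) s 0 0 0

theorem mul_eps_mem {x : A} (hx : x ∈ monomialSpan K e a b ε) :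
    x * ε ∈ monomialSpan K e a b ε :=
  monomialSpan_mul_mem (fun s i k l => by
    rcases l with _ | l
    · rw [pow_zero, mul_one, mul_assoc, ← pow_succ, ← mul_one (_ * _), ← pow_zero a]
      exact monomial_mem _ _ _ _
    · rw [pow_succ a, ← mul_assoc, mul_assoc _ a, h.a_mul_eps, mul_zero]
      exact zero_mem _) hx

theorem mul_b_mem {x : A} (hx : x ∈ monomialSpan K e a b ε) :
    x * b ∈ monomialSpan K e a b ε := by
  have h0 : ∀ s i k l, e s * b ^ i * ε ^ k * b * a ^ l ∈ monomialSpan K e a b ε := by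
    intro s i k l
    rcases k with _ | k
    · have := monomial_mem (K := K) (e := e) (a := a) (b := b) (ε := ε) s (i + 1) 0 l
      simpa [pow_succ, mul_assoc] using this
    · rw [pow_succ ε, ← mul_assoc, mul_assoc _ ε, h.eps_mul_b, mul_zero, zero_mul]
      exact zero_mem _
  refine monomialSpan_mul_mem (fun s i k l => ?_) hx
  rcases l with _ | l
  · simpa using h0 s i k 0
  · rw [mul_assoc, h.a_pow_succ_mul_b, mul_add, ← mul_assoc, ← mul_assoc]
    refine add_mem (h0 s i k (l + 1)) ?_
    have := aeval_mem_monomialSpan (e := e) (a := a) (b := b) (ε := ε) s i l (X ^ k * q)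
    simpa [mul_assoc] using this

theorem mul_e_mem (t : ℕ) {x : A} (hx : x ∈ monomialSpan K e a b ε) :
    x * e t ∈ monomialSpan K e a b ε := by
  refine monomialSpan_mul_mem (fun s i k l => ?_) hx
  rcases lt_or_ge t l with hl | hl
  · rw [mul_assoc, h.a_pow_mul_e_of_lt hl, mul_zero]
    exact zero_mem _
  obtain ⟨d, rfl⟩ := Nat.exists_eq_add_of_le' hl
  rw [mul_assoc, ← h.e_mul_a_pow, ← mul_assoc]
  rcases k with _ | k
  · rw [pow_zero, mul_one, mul_assoc (e s), ← h.e_mul_b_pow, ← mul_assoc]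
    by_cases hs : s = d + i
    · rw [hs, h.idem]
      simpa using monomial_mem (K := K) (e := e) (a := a) (b := b) (ε := ε) (d + i) i 0 l
    · rw [h.orth _ _ hs, zero_mul, zero_mul]
      exact zero_mem _
  · rw [mul_assoc _ (ε ^ (k + 1)), pow_succ, mul_assoc (ε ^ k)]
    by_cases hd : d = 0
    · rw [hd, h.eps_mul_e_zero, ← pow_succ]
      exact monomial_mem _ _ _ _
    · rw [h.eps_mul_e hd, mul_zero, mul_zero, zero_mul]
      exact zero_mem _

/-- The monomials `e_s b^i ε^k a^l` span, if the algebra is generated by the `e_s` and by the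
homogeneous components of `a`, `b` and `ε`. -/
theorem monomialSpan_eq_top {ι : Type*} {π : FreeAlgebra K ι →ₐ[K] A}
    (hπ : Function.Surjective π)
    (hgen : ∀ v, (∃ s, π (FreeAlgebra.ι K v) = e s) ∨ (∃ s, π (FreeAlgebra.ι K v) = e s * a) ∨
      (∃ s, π (FreeAlgebra.ι K v) = e s * b) ∨ π (FreeAlgebra.ι K v) = ε) :
    monomialSpan K e a b ε = ⊤ := by
  -- The span contains 1, so stability under right multiplication by the generators suffices.
  have key : ∀ w : FreeAlgebra K ι, ∀ x ∈ monomialSpan K e a b ε,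
      x * π w ∈ monomialSpan K e a b ε := by
    intro w
    induction w using FreeAlgebra.induction with
    | grade0 r =>
      intro x hx
      rw [AlgHom.commutes, ← Algebra.commutes, ← Algebra.smul_def]
      exact Submodule.smul_mem _ _ hx
    | grade1 v =>
      intro x hx
      rcases hgen v with ⟨s, hs⟩ | ⟨s, hs⟩ | ⟨s, hs⟩ | hs <;> rw [hs]
      · exact h.mul_e_mem s hx
      · rw [← mul_assoc]; exact mul_a_mem (h.mul_e_mem s hx)
      · rw [← mul_assoc]; exact h.mul_b_mem (h.mul_e_mem s hx)
      · exact h.mul_eps_mem hx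
    | mul v w hv hw =>
      intro x hx
      rw [map_mul, ← mul_assoc]; exact hw _ (hv x hx)
    | add v w hv hw =>
      intro x hx
      rw [map_add, mul_add]; exact add_mem (hv x hx) (hw x hx)
  refine eq_top_iff.2 fun x _ => ?_
  obtain ⟨w, rfl⟩ := hπ x
  simpa using key w 1 h.one_mem_monomialSpan

end

/-- The elements congruent modulo `[A, A]` to `∑ c_s e_s + f(ε)` with `f(0) = 0`. -/
noncomputable def normalForms (K : Type*) {A : Type*} [Field K] [Ring A] [Algebra K A] (e : ℕ → A)
    (ε : A) : Submodule K A :=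
  commutatorSpace K A ⊔ (Submodule.span K (Set.range e) ⊔
    ((Ideal.span {(X : K[X])}).restrictScalars K).map (aeval (R := K) ε).toLinearMap)

theorem commutatorSpace_le : commutatorSpace K A ≤ normalForms K e ε := le_sup_left

theorem e_mem (s : ℕ) : e s ∈ normalForms K e ε :=
  (le_sup_left.trans le_sup_right : _ ≤ normalForms K e ε) (Submodule.subset_span ⟨s, rfl⟩)

theorem aeval_mem {f : K[X]} (hf : X ∣ f) : aeval ε f ∈ normalForms K e ε :=
  (le_sup_right.trans le_sup_right : _ ≤ normalForms K e ε)
    ⟨f, Ideal.mem_span_singleton.2 hf, rfl⟩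

theorem mul_comm_mem {x y : A} (hxy : y * x ∈ normalForms K e ε) :
    x * y ∈ normalForms K e ε := by
  have := add_mem (commutatorSpace_le (e := e) (ε := ε) (commutator_mem_commutatorSpace K x y)) hxy
  rwa [sub_add_cancel] at this

/-! ### Reduction modulo commutators -/

section

variable (h : LRelations K n q e a b ε)
include h

/-- Since f(ε)b = 0, moving one b through the a's leaves only the correction term: one a and one b
disappear and f becomes fq. If only a's remain, rotating one of them to the front gives af(ε) = 0.
-/
theorem aeval_mul_a_pow_mul_b_pow_mem (i l : ℕ) {f : K[X]} (hf : X ∣ f) :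
    aeval ε f * a ^ l * b ^ i ∈ normalForms K e ε := by
  induction l generalizing i f with
  | zero =>
    rcases i with _ | i
    · simpa using aeval_mem hf
    · rw [pow_zero, mul_one, pow_succ', ← mul_assoc, h.aeval_mul_b hf, zero_mul]
      exact zero_mem _
  | succ l ih =>
    rcases i with _ | i
    · rw [pow_zero, mul_one]
      apply mul_comm_mem
      rw [pow_succ, mul_assoc, h.a_mul_aeval hf, mul_zero]
      exact zero_mem _
    · rw [pow_succ' b, ← mul_assoc, mul_assoc _ _ b, h.a_pow_succ_mul_b, mul_add, ← mul_assoc,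
        h.aeval_mul_b hf, zero_mul, zero_add, ← mul_assoc, ← map_mul]
      exact ih i (hf.mul_right q)

theorem e_mul_aeval_mem (s i l : ℕ) {f : K[X]} (hf : X ∣ f) :
    e s * b ^ i * aeval ε f * a ^ l ∈ normalForms K e ε := by
  rw [mul_assoc]
  apply mul_comm_mem
  rw [← mul_assoc]
  rcases lt_or_ge s l with hl | hl
  · rw [mul_assoc (aeval ε f), h.a_pow_mul_e_of_lt hl, mul_zero, zero_mul]
    exact zero_mem _
  obtain ⟨d, rfl⟩ := Nat.exists_eq_add_of_le' hl
  rw [mul_assoc (aeval ε f), ← h.e_mul_a_pow, ← mul_assoc]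
  by_cases hd : d = 0
  · rw [hd, h.aeval_mul_e_zero hf]
    exact h.aeval_mul_a_pow_mul_b_pow_mem i l hf
  · rw [h.aeval_mul_e hf hd, zero_mul, zero_mul]
    exact zero_mem _

/-- Rotating a single arrow cyclically carries e_{s+1} b^i a^l to e_s b^i a^l with the same
exponents, up to a term containing q(ε). Induction on the vertex descends to e_0, where only i = l =
0 contributes. -/
theorem e_mul_b_pow_mul_a_pow_mem (s i l : ℕ) : e s * b ^ i * a ^ l ∈ normalForms K e ε := by
  induction s with
  | zero =>
    rcases i with _ | i
    · rcases l with _ | l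
      · simpa using e_mem 0
      · rw [pow_zero, mul_one]
        apply mul_comm_mem
        rw [h.a_pow_mul_e_of_lt l.succ_pos]
        exact zero_mem _
    · rw [h.e_mul_b_pow_of_lt i.succ_pos, zero_mul]
      exact zero_mem _
  | succ s ih =>
    rcases l with _ | l
    · rcases i with _ | i
      · simpa using e_mem (s + 1)
      · rw [pow_zero, mul_one, pow_succ', ← mul_assoc, h.e_succ_mul_b, mul_assoc]
        apply mul_comm_mem
        rw [mul_assoc, ← pow_succ]
        simpa using ih
    · rw [pow_succ a, ← mul_assoc]
      apply mul_comm_mem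
      rw [← mul_assoc, ← mul_assoc, ← h.e_mul_a]
      rcases i with _ | i
      · simpa [pow_succ', mul_assoc] using ih
      · rw [mul_assoc (e s), h.a_mul_b_pow_succ, mul_add, add_mul, ← mul_assoc, ← mul_assoc,
          mul_assoc _ a, ← pow_succ']
        exact add_mem ih (h.e_mul_aeval_mem s i l h.X_dvd)

theorem monomialSpan_le_normalForms : monomialSpan K e a b ε ≤ normalForms K e ε := by
  refine Submodule.span_le.2 ?_
  rintro _ ⟨⟨s, i, k, l⟩, rfl⟩
  change e s * b ^ i * ε ^ k * a ^ l ∈ normalForms K e ε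
  rcases k with _ | k
  · simpa using h.e_mul_b_pow_mul_a_pow_mem s i l
  · simpa using h.e_mul_aeval_mem s i l (dvd_pow_self (X : K[X]) k.succ_ne_zero)

theorem exists_normalForm {x : A} (hx : x ∈ normalForms K e ε) : ∃ (c : ℕ → K) (f : K[X]),
    x - (∑ s ∈ Finset.range n, c s • e s + aeval ε (X * f)) ∈ commutatorSpace K A := by
  obtain ⟨y, hy, _, hzw, rfl⟩ := Submodule.mem_sup.1 hx
  obtain ⟨z, hz, w, hw, rfl⟩ := Submodule.mem_sup.1 hzw
  obtain ⟨c, hc⟩ : ∃ c : ℕ → K, ∑ s ∈ Finset.range n, c s • e s = z := by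
    clear hx hy hzw
    induction hz using Submodule.span_induction with
    | mem z hz =>
      obtain ⟨s, rfl⟩ := hz
      by_cases hs : s < n
      · refine ⟨fun t => if t = s then 1 else 0, ?_⟩
        simp [ite_smul, hs]
      · exact ⟨0, by simp [h.e_eq_zero s (not_lt.1 hs)]⟩
    | zero => exact ⟨0, by simp⟩
    | add z w _ _ hz hw =>
      obtain ⟨c, rfl⟩ := hz
      obtain ⟨d, rfl⟩ := hw
      exact ⟨c + d, by simp [add_smul, Finset.sum_add_distrib]⟩
    | smul r z _ hz =>
      obtain ⟨c, rfl⟩ := hz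
      exact ⟨r • c, by simp [mul_smul, Finset.smul_sum]⟩
  obtain ⟨f, hf, rfl⟩ := hw
  obtain ⟨f, rfl⟩ := Ideal.mem_span_singleton.1 hf
  refine ⟨c, f, ?_⟩
  rw [hc, AlgHom.toLinearMap_apply, add_sub_cancel_right]
  exact hy

/-- In (ba + q(ε))^k the mixed products vanish, as aq(ε) = 0 = q(ε)b. Hence q(ε)^k = (ab)^k -
(ba)^k, the commutator of a and b(ab)^(k-1). -/
theorem aeval_pow_mem_commutatorSpace {k : ℕ} (hk : k ≠ 0) :
    aeval ε (q ^ k) ∈ commutatorSpace K A := by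
  obtain ⟨k, rfl⟩ := Nat.exists_eq_add_one_of_ne_zero hk
  have h1 : ∀ k, (a * b) ^ (k + 1) = (b * a) ^ (k + 1) + aeval ε q ^ (k + 1) := by
    intro k
    induction k with
    | zero => simpa using h.a_mul_b
    | succ k ih =>
      have h2 : (b * a) ^ (k + 1) * aeval ε q = 0 := by
        rw [pow_succ, mul_assoc, mul_assoc, h.a_mul_aeval h.X_dvd, mul_zero, mul_zero]
      have h3 : aeval ε q ^ (k + 1) * (b * a) = 0 := by
        rw [pow_succ, mul_assoc, ← mul_assoc _ b, h.aeval_mul_b h.X_dvd, zero_mul, mul_zero]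
      rw [pow_succ, ih, h.a_mul_b, add_mul, mul_add, mul_add, h2, h3, add_zero, zero_add,
        ← pow_succ, ← pow_succ]
  rw [map_pow, ← sub_eq_iff_eq_add'.2 (h1 k)]
  have h4 : ∀ k, (b * a) ^ (k + 1) = b * (a * b) ^ k * a := by
    intro k
    induction k with
    | zero => simp
    | succ k ih => rw [pow_succ, ih, pow_succ]; noncomm_ring
  rw [h4, pow_succ', mul_assoc a b]
  exact commutator_mem_commutatorSpace K a (b * (a * b) ^ k)

theorem aeval_mem_commutatorSpace {f : K[X]}
    (hf : ∃ g r : K[X], X * f = aeval q g + X ^ (2 * n) * r) (hn : n ≠ 0) :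
    aeval ε (X * f) ∈ commutatorSpace K A := by
  obtain ⟨g, r, hg⟩ := hf
  -- Only positive powers of q(ε) are known to be commutators. Comparing constant terms excludes the
  -- zeroth power, because X divides q and n is nonzero.
  have h0 : g.coeff 0 = 0 := by
    obtain ⟨q', hq'⟩ := h.X_dvd
    have h1 := congrArg (coeff · 0) hg
    simp only [mul_coeff_zero, coeff_X_zero, zero_mul, coeff_add, ← comp_eq_aeval] at h1
    rw [coeff_zero_eq_eval_zero (g.comp q), eval_comp, hq'] at h1
    simp [hn, ← coeff_zero_eq_eval_zero] at h1
    exact h1.symm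
  rw [hg, map_add, map_mul, map_pow, aeval_X, h.eps_pow, zero_mul, add_zero,
    aeval_eq_sum_range (p := g), map_sum]
  refine sum_mem fun k _ => ?_
  rcases eq_or_ne k 0 with rfl | hk
  · rw [h0, zero_smul, map_zero]
    exact Submodule.zero_mem _
  · rw [map_smul]
    exact Submodule.smul_mem _ _ (h.aeval_pow_mem_commutatorSpace hk)

end

end LRelations

/-! ### Path algebras -/

namespace PathAlgebra

variable {K : Type*} [Field K] {V E : Type*} [Fintype V] {s t : E → V}

/-- The quotient map from the free algebra on vertices and arrows. -/
noncomputable def ofFree (K : Type*) [Field K] {V E : Type*} [Fintype V] (s t : E → V) :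
    FreeAlgebra K (V ⊕ E) →ₐ[K] PathAlgebra K s t :=
  RingQuot.mkAlgHom K (PathRel K s t)

/-- The trivial path at a vertex. -/
noncomputable def vertex (K : Type*) [Field K] {V E : Type*} [Fintype V] (s t : E → V) (v : V) :
    PathAlgebra K s t :=
  ofFree K s t (FreeAlgebra.ι K (Sum.inl v))

theorem ofFree_surjective : Function.Surjective (ofFree K s t) :=
  RingQuot.mkAlgHom_surjective K _

theorem ofFree_rel {x y : FreeAlgebra K (V ⊕ E)} (h : PathRel K s t x y) :
    ofFree K s t x = ofFree K s t y :=
  RingQuot.mkAlgHom_rel K h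

theorem vertex_mul_self (v : V) : vertex K s t v * vertex K s t v = vertex K s t v :=
  (map_mul _ _ _).symm.trans (ofFree_rel (PathRel.idem v))

theorem vertex_mul_vertex {v w : V} (h : v ≠ w) : vertex K s t v * vertex K s t w = 0 :=
  ((map_mul _ _ _).symm.trans (ofFree_rel (PathRel.orth v w h))).trans (map_zero _)

theorem sum_vertex : ∑ v, vertex K s t v = 1 :=
  ((map_sum _ _ _).symm.trans (ofFree_rel PathRel.sum_one)).trans (map_one _)

theorem vertex_mul_arrow (α : E) : vertex K s t (s α) * arrow K s t α = arrow K s t α :=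
  (map_mul _ _ _).symm.trans (ofFree_rel (PathRel.source α))

theorem arrow_mul_vertex (α : E) : arrow K s t α * vertex K s t (t α) = arrow K s t α :=
  (map_mul _ _ _).symm.trans (ofFree_rel (PathRel.target α))

theorem induction_on {C : PathAlgebra K s t → Prop} (x : PathAlgebra K s t)
    (algebraMap : ∀ r, C (algebraMap K _ r)) (vertex : ∀ v, C (vertex K s t v))
    (arrow : ∀ α, C (arrow K s t α)) (mul : ∀ x y, C x → C y → C (x * y))
    (add : ∀ x y, C x → C y → C (x + y)) : C x := by
  obtain ⟨w, rfl⟩ := ofFree_surjective x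
  induction w using FreeAlgebra.induction with
  | grade0 r => rw [AlgHom.commutes]; exact algebraMap r
  | grade1 v => rcases v with v | α; exacts [vertex v, arrow α]
  | mul x y hx hy => rw [map_mul]; exact mul _ _ hx hy
  | add x y hx hy => rw [map_add]; exact add _ _ hx hy

section lift

variable {B : Type*} [Ring B] [Algebra K B]

/-- The algebra homomorphism given by images of the vertices and the arrows. -/
noncomputable def lift (φ : V ⊕ E → B)
    (h : ∀ ⦃x y⦄, PathRel K s t x y → FreeAlgebra.lift K φ x = FreeAlgebra.lift K φ y) :
    PathAlgebra K s t →ₐ[K] B :=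
  RingQuot.liftAlgHom K ⟨FreeAlgebra.lift K φ, h⟩

variable (φ : V ⊕ E → B)
  (h : ∀ ⦃x y⦄, PathRel K s t x y → FreeAlgebra.lift K φ x = FreeAlgebra.lift K φ y)

theorem lift_ofFree (x : FreeAlgebra K (V ⊕ E)) :
    lift φ h (ofFree K s t x) = FreeAlgebra.lift K φ x :=
  RingQuot.liftAlgHom_mkAlgHom_apply K _ _ _

theorem lift_vertex (v : V) : lift φ h (vertex K s t v) = φ (Sum.inl v) :=
  (lift_ofFree φ h _).trans (FreeAlgebra.lift_ι_apply _ _)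

theorem lift_arrow (α : E) : lift φ h (arrow K s t α) = φ (Sum.inr α) :=
  (lift_ofFree φ h _).trans (FreeAlgebra.lift_ι_apply _ _)

end lift

section toMatrix

variable [DecidableEq V] {R : Type*} [CommRing R] [Algebra K R]

theorem toMatrix_aux (wt : E → R) ⦃x y : FreeAlgebra K (V ⊕ E)⦄ (h : PathRel K s t x y) :
    FreeAlgebra.lift K (Sum.elim (fun v => Matrix.single v v (1 : R))
      (fun α => Matrix.single (s α) (t α) (wt α))) x =
    FreeAlgebra.lift K (Sum.elim (fun v => Matrix.single v v (1 : R))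
      (fun α => Matrix.single (s α) (t α) (wt α))) y := by
  cases h with
  | idem v => simp
  | orth v w h => simp [Matrix.single_mul_single_of_ne, h]
  | sum_one =>
    simp only [map_sum, FreeAlgebra.lift_ι_apply, Sum.elim_inl, map_one]
    exact Matrix.sum_single_one
  | source α => simp
  | target α => simp

/-- The representation by matrices which sends each arrow to a weighted matrix unit. -/
noncomputable def toMatrix (wt : E → R) : PathAlgebra K s t →ₐ[K] Matrix V V R :=
  lift _ (toMatrix_aux wt)

theorem toMatrix_vertex (wt : E → R) (v : V) :
    toMatrix wt (vertex K s t v) = Matrix.single v v 1 :=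
  lift_vertex _ _ _

theorem toMatrix_arrow (wt : E → R) (α : E) :
    toMatrix wt (arrow K s t α) = Matrix.single (s α) (t α) (wt α) :=
  lift_arrow _ _ _

end toMatrix

theorem simple_aux [DecidableEq V] (v₀ : V) ⦃x y : FreeAlgebra K (V ⊕ E)⦄
    (h : PathRel K s t x y) :
    FreeAlgebra.lift K (Sum.elim (fun v => if v = v₀ then (1 : K) else 0) (fun _ => 0)) x =
    FreeAlgebra.lift K (Sum.elim (fun v => if v = v₀ then (1 : K) else 0) (fun _ => 0)) y := by
  cases h with
  | idem v => simp
  | orth v w h =>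
    simp only [map_mul, map_zero, FreeAlgebra.lift_ι_apply, Sum.elim_inl]
    split_ifs with h1 h2 <;> simp_all
  | sum_one => simp
  | source α => simp
  | target α => simp

/-- The one-dimensional representation concentrated at a vertex. -/
noncomputable def simple (K : Type*) [Field K] {V E : Type*} [Fintype V] (s t : E → V)
    [DecidableEq V] (v₀ : V) : PathAlgebra K s t →ₐ[K] K :=
  lift _ (simple_aux v₀)

theorem simple_vertex [DecidableEq V] (v₀ v : V) :
    simple K s t v₀ (vertex K s t v) = if v = v₀ then 1 else 0 :=
  lift_vertex _ _ _

theorem simple_arrow [DecidableEq V] (v₀ : V) (α : E) :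
    simple K s t v₀ (arrow K s t α) = 0 :=
  lift_arrow _ _ _

end PathAlgebra

/-! ### Trace functions on quotients -/

/-- The congruence of all pairs which a trace function cannot distinguish. -/
def traceCon {K P Q : Type*} [Field K] [Ring P] [Algebra K P] [AddCommGroup Q] [Module K Q]
    (t : P →ₗ[K] Q) (ht : ∀ x y, t (x * y) = t (y * x)) : RingCon P where
  r x y := ∀ w, t (x * w) = t (y * w)
  iseqv := ⟨fun _ _ => rfl, fun h w => (h w).symm, fun h h' w => (h w).trans (h' w)⟩
  add' h h' w := by rw [add_mul, add_mul, map_add, map_add, h, h']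
  mul' {x y x' y'} h h' w := by
    rw [mul_assoc, h, ht, mul_assoc, h', ← mul_assoc, ht, mul_assoc]

/-- A trace function descends to a quotient if it kills the ideal generated by the relations. -/
theorem exists_trace_ringQuot {K P Q : Type*} [Field K] [Ring P] [Algebra K P] [AddCommGroup Q]
    [Module K Q] (t : P →ₗ[K] Q) (ht : ∀ x y, t (x * y) = t (y * x)) (r : P → P → Prop)
    (hr : ∀ x y, r x y → ∀ w, t (x * w) = t (y * w)) :
    ∃ χ : RingQuot r →ₗ[K] Q, ∀ x, χ (RingQuot.mkAlgHom K r x) = t x := by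
  have hker : LinearMap.ker (RingQuot.mkAlgHom K r).toLinearMap ≤ LinearMap.ker t := by
    intro x hx
    -- The relations lie in the congruence `traceCon t ht`, so the quotient maps onto its quotient.
    -- An element of the kernel is thus congruent to 0, and testing with w = 1 gives t x = 0.
    let g : RingQuot r →+* (traceCon t ht).Quotient :=
      RingQuot.lift ⟨(traceCon t ht).mk', fun x y h => (RingCon.eq _).2 (hr x y h)⟩
    have h1 : g (RingQuot.mkRingHom r x) = (traceCon t ht).mk' x :=
      RingQuot.lift_mkRingHom_apply _ _ _
    rw [LinearMap.mem_ker, AlgHom.toLinearMap_apply, ← AlgHom.coe_toRingHom,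
      ← AlgHom.toRingHom_eq_coe] at hx
    have h2 : RingQuot.mkRingHom r x = 0 := by
      rw [← RingQuot.mkAlgHom_coe K]; exact hx
    rw [h2, map_zero, ← map_zero (traceCon t ht).mk'] at h1
    have h3 : ∀ w, t (0 * w) = t (x * w) := (RingCon.eq _).1 h1
    simpa using (h3 1).symm
  refine ⟨(Submodule.liftQ _ t hker) ∘ₗ
    ((RingQuot.mkAlgHom K r).toLinearMap.quotKerEquivOfSurjective
      (RingQuot.mkAlgHom_surjective K r)).symm.toLinearMap, fun x => ?_⟩
  have : ((RingQuot.mkAlgHom K r).toLinearMap.quotKerEquivOfSurjective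
    (RingQuot.mkAlgHom_surjective K r)).symm (RingQuot.mkAlgHom K r x) =
      Submodule.Quotient.mk x := by
    rw [LinearEquiv.symm_apply_eq]; rfl
  rw [LinearMap.comp_apply, LinearEquiv.coe_coe, this]
  exact Submodule.liftQ_apply _ _ _

/-! ### The matrix model of `L_n` -/

namespace LPathAlgebra

open Polynomial

variable {K : Type*} [Field K] {n : ℕ} [NeZero n]

/-- The weights of the arrows in the matrix model. -/
noncomputable def weight (u : K[X]) : LArrow n → K[X]
  | LArrow.eps => X
  | LArrow.a _ => 1
  | LArrow.abar _ => u

/-- The matrix model of the path algebra of type `L_n`. -/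
noncomputable def model (u : K[X]) : LPathAlgebra K n →ₐ[K] Matrix (Fin n) (Fin n) K[X] :=
  PathAlgebra.toMatrix (weight u)

theorem model_eps (u : K[X]) : model u (eps K n) = Matrix.single 0 0 X :=
  PathAlgebra.toMatrix_arrow _ _

theorem model_a (u : K[X]) (i : Fin (n - 1)) :
    model u (a K n i) = Matrix.single ⟨i, by omega⟩ ⟨i + 1, by omega⟩ 1 :=
  PathAlgebra.toMatrix_arrow _ _

theorem model_abar (u : K[X]) (i : Fin (n - 1)) :
    model u (abar K n i) = Matrix.single ⟨i + 1, by omega⟩ ⟨i, by omega⟩ u :=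
  PathAlgebra.toMatrix_arrow _ _

theorem model_eps_pow (u : K[X]) {k : ℕ} (hk : k ≠ 0) :
    model u (eps K n ^ k) = Matrix.single 0 0 (X ^ k) := by
  obtain ⟨k, rfl⟩ := Nat.exists_eq_add_one_of_ne_zero hk
  rw [map_pow, model_eps]
  induction k with
  | zero => simp
  | succ k ih => rw [pow_succ, ih k.succ_ne_zero, Matrix.single_mul_single_same, ← pow_succ]

/-- The entries of the matrix model are in `u ^ d K[u] + u ^ s K[X]`. -/
noncomputable def modelEntries (u : K[X]) (d s : ℕ) : Submodule K K[X] where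
  carrier := {f | ∃ g r : K[X], f = u ^ d * aeval u g + u ^ s * r}
  zero_mem' := ⟨0, 0, by simp⟩
  add_mem' := by
    rintro _ _ ⟨g, r, rfl⟩ ⟨g', r', rfl⟩
    exact ⟨g + g', r + r', by rw [map_add]; ring⟩
  smul_mem' := by
    rintro c _ ⟨g, r, rfl⟩
    exact ⟨c • g, c • r, by simp [smul_add]⟩

/-- The truncated differences satisfy (s - t) + (t - r) ≥ s - r and (s - t) + t ≥ s. Surplus factors
u are absorbed into K[u] or into the remainder. -/
theorem mul_mem_modelEntries {u f f' : K[X]} {s t r : ℕ} (h : f ∈ modelEntries u (s - t) s)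
    (h' : f' ∈ modelEntries u (t - r) t) : f * f' ∈ modelEntries u (s - r) s := by
  obtain ⟨g, x, rfl⟩ := h
  obtain ⟨g', x', rfl⟩ := h'
  obtain ⟨k, hk⟩ := Nat.exists_eq_add_of_le' (show s - r ≤ (s - t) + (t - r) by omega)
  obtain ⟨l, hl⟩ := Nat.exists_eq_add_of_le' (show s ≤ (s - t) + t by omega)
  refine ⟨X ^ k * (g * g'), u ^ l * aeval u g * x' + x * (u ^ (t - r) * aeval u g' + u ^ t * x'),
    ?_⟩
  simp only [map_mul, map_pow, aeval_X]
  calc _ = u ^ (s - t + (t - r)) * (aeval u g * aeval u g') + u ^ (s - t + t) * aeval u g * x'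
      + u ^ s * x * (u ^ (t - r) * aeval u g' + u ^ t * x') := by ring
    _ = _ := by rw [hk, hl]; ring

/-- A path from s to t < s takes at least s - t downward arrows, each of weight u. Only the loop at
0 brings in polynomials outside K[u], and reaching it from s already costs u^s. -/
theorem model_apply_mem (u : K[X]) (x : LPathAlgebra K n) (s t : Fin n) :
    model u x s t ∈ modelEntries u ((s : ℕ) - t) s := by
  have hdiag : ∀ (c : K) (s : ℕ), C c ∈ modelEntries u (s - s) s := fun c s => ⟨C c, 0, by simp⟩
  have hsingle : ∀ (s t i j : Fin n) (f : K[X]), f ∈ modelEntries u ((i : ℕ) - j) i →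
      Matrix.single i j f s t ∈ modelEntries u ((s : ℕ) - t) s := by
    intro s t i j f hf
    rw [Matrix.single_apply]
    split_ifs with h
    · rw [← h.1, ← h.2]; exact hf
    · exact zero_mem _
  induction x using PathAlgebra.induction_on generalizing s t with
  | algebraMap r =>
    rw [AlgHom.commutes, Matrix.algebraMap_matrix_apply]
    split_ifs with h
    · rw [h]; exact hdiag r t
    · exact zero_mem _
  | vertex v =>
    rw [model, PathAlgebra.toMatrix_vertex]
    exact hsingle _ _ _ _ _ (hdiag 1 v)
  | arrow α =>
    rw [model, PathAlgebra.toMatrix_arrow]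
    apply hsingle
    rcases α with _ | i | i
    · exact ⟨0, X, by simp [weight, LArrow.source]⟩
    · exact ⟨1, 0, by simp [weight, LArrow.source, LArrow.target]⟩
    · exact ⟨1, 0, by simp [weight, LArrow.source, LArrow.target]⟩
  | mul x y hx hy =>
    rw [map_mul, Matrix.mul_apply]
    exact sum_mem fun r _ => mul_mem_modelEntries (hx s r) (hy r t)
  | add x y hx hy => rw [map_add]; exact add_mem (hx s t) (hy s t)

/-- The trace of the matrix model, modulo `K[u] + X ^ (2 n) K[X]`. -/
noncomputable def modelTrace (K : Type*) [Field K] (n : ℕ) [NeZero n] (j : ℕ) :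
    LPathAlgebra K n →ₗ[K] K[X] ⧸ adjoinModPow K j (2 * n) :=
  (adjoinModPow K j (2 * n)).mkQ ∘ₗ ((Matrix.traceLinearMap (Fin n) K K[X]) ∘ₗ
    (model (deformationPoly K j)).toLinearMap)

theorem modelTrace_apply (j : ℕ) (x : LPathAlgebra K n) :
    modelTrace K n j x =
      (adjoinModPow K j (2 * n)).mkQ (model (deformationPoly K j) x).trace := rfl

theorem modelTrace_mul_comm (j : ℕ) (x y : LPathAlgebra K n) :
    modelTrace K n j (x * y) = modelTrace K n j (y * x) := by
  rw [modelTrace_apply, modelTrace_apply, map_mul, Matrix.trace_mul_comm, ← map_mul]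

theorem model_deformed (j : ℕ) (u : K[X]) :
    model (n := n) u (eps K n ^ 2) + model u (eps K n ^ 3 * aeval (eps K n) (X ^ (2 * j) : K[X])) =
      Matrix.single 0 0 (deformationPoly K j) := by
  rw [map_pow (aeval _), aeval_X, ← pow_add, model_eps_pow u two_ne_zero,
    model_eps_pow u (by omega),
    deformationPoly, pow_add X 3 (2 * j), Matrix.single_add]

/-- The relations `mesh` and `deformed` hold in the matrix model, as two equal diagonal entries u
cancel in characteristic two. The others become a single diagonal entry and vanish only after taking
the trace modulo V_{2n}. -/
theorem modelTrace_rel [CharP K 2] (j : ℕ) ⦃x y : LPathAlgebra K n⦄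
    (h : DeformedRel K n (X ^ (2 * j)) x y) (w : LPathAlgebra K n) :
    modelTrace K n j (x * w) = modelTrace K n j (y * w) := by
  set u := deformationPoly K j with hu
  have hX : (X : K[X]) ^ 2 ∣ u := ⟨1 + X * X ^ (2 * j), by rw [hu, deformationPoly]; ring⟩
  have hzero : ∀ {x : LPathAlgebra K n}, model u x = 0 →
      modelTrace K n j (x * w) = modelTrace K n j (0 * w) := by
    intro x hx
    rw [zero_mul, map_zero, modelTrace_apply, map_mul, hx, zero_mul, Matrix.trace_zero, map_zero]
  have hsingle : ∀ {x : LPathAlgebra K n} {s : Fin n} {f : K[X]},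
      model u x = Matrix.single s s f → f * model u w s s ∈ adjoinModPow K j (2 * n) →
      modelTrace K n j (x * w) = modelTrace K n j (0 * w) := by
    intro x s f hx hf
    rw [zero_mul, map_zero, modelTrace_apply, map_mul, hx, Matrix.trace_single_mul]
    exact (Submodule.Quotient.mk_eq_zero _).2 hf
  -- At the last vertex the diagonal entry is in K[u] + u^(n-1) K[X]. Multiplying by u gives K[u] +
  -- u^n K[X], and X^(2n) divides u^n.
  have hmem : ∀ s : Fin n, (s : ℕ) + 1 = n → u * model u w s s ∈ adjoinModPow K j (2 * n) := by
    intro s hs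
    obtain ⟨g, r, hg⟩ := model_apply_mem u w s s
    obtain ⟨v, hv⟩ := pow_dvd_pow_of_dvd hX n
    refine adjoinModPow.mem_iff.2 ⟨X * g, v * r, ?_⟩
    rw [hg, Nat.sub_self, map_mul, aeval_X, ← hu, ← mul_assoc (X ^ (2 * n)), pow_mul, ← hv,
      show u ^ n = u * u ^ (s : ℕ) by rw [← pow_succ', hs]]
    ring
  cases h with
  | mesh i h =>
    apply hzero
    rw [map_add, map_mul, map_mul, model_a, model_a, model_abar, model_abar]
    simp only [Matrix.single_mul_single_same, one_mul, mul_one]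
    rw [← Matrix.single_add, CharTwo.add_self_eq_zero, Matrix.single_zero]
  | last h =>
    refine hsingle (s := ⟨n - 2 + 1, by omega⟩) (f := u) ?_ (hmem _ ?_)
    · rw [map_mul, model_a, model_abar, Matrix.single_mul_single_same, mul_one]
    · simp only; omega
  | eps_pow =>
    exact hsingle (model_eps_pow u (by have := NeZero.ne n; omega))
      (adjoinModPow.X_pow_mul_mem le_rfl _)
  | deformed h =>
    apply hzero
    rw [add_right_comm, map_add, map_add, model_deformed, map_mul, model_a, model_abar,
      Matrix.single_mul_single_same, one_mul]
    change Matrix.single (0 : Fin n) 0 u + Matrix.single 0 0 u = 0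
    rw [← Matrix.single_add, CharTwo.add_self_eq_zero, Matrix.single_zero]
  | deformed_one h =>
    -- For n = 1 the vertex 0 is also the last vertex.
    refine hsingle (s := 0) (f := u) ?_ (hmem _ ?_)
    · rw [map_add, model_deformed]
    · simp [h]

theorem simple_rel (p : K[X]) (s : Fin n) ⦃x y : LPathAlgebra K n⦄ (h : DeformedRel K n p x y) :
    PathAlgebra.simple K (LArrow.source (n := n)) LArrow.target s x =
      PathAlgebra.simple K (LArrow.source (n := n)) LArrow.target s y := by
  cases h <;>
  simp [eps, a, abar, PathAlgebra.simple_arrow, NeZero.ne n]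

end LPathAlgebra

/-! ### The generators of `L_n` -/

theorem sum_range_add_sum_range_of_telescoping {M : Type*} [AddCommGroup M] {x y : ℕ → M} {m : ℕ}
    (hm : 0 < m) (h : ∀ i, i + 1 < m → x (i + 1) + y i = 0) (hlast : y (m - 1) = 0) :
    ∑ i ∈ Finset.range m, x i + ∑ i ∈ Finset.range m, y i = x 0 := by
  obtain ⟨m, rfl⟩ := Nat.exists_eq_add_one_of_ne_zero hm.ne'
  rw [Finset.sum_range_succ' x, Finset.sum_range_succ y, ← Nat.add_sub_cancel m 1, hlast,
    Nat.add_sub_cancel, add_zero, add_right_comm, ← Finset.sum_add_distrib,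
    Finset.sum_eq_zero, zero_add]
  intro i hi
  exact h i (by simpa using hi)

namespace DeformedPreprojectiveL

open Polynomial

variable {K : Type*} [Field K] {n : ℕ} [NeZero n] {p : K[X]}

/-- The quotient map from the path algebra. -/
noncomputable def ofPath (K : Type*) [Field K] (n : ℕ) [NeZero n] (p : K[X]) :
    LPathAlgebra K n →ₐ[K] DeformedPreprojectiveL K n p :=
  RingQuot.mkAlgHom K (DeformedRel K n p)

theorem ofPath_surjective : Function.Surjective (ofPath K n p) :=
  RingQuot.mkAlgHom_surjective K _

theorem ofPath_rel {x : LPathAlgebra K n} (h : DeformedRel K n p x 0) : ofPath K n p x = 0 :=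
  (RingQuot.mkAlgHom_rel K h).trans (map_zero (RingQuot.mkAlgHom K (DeformedRel K n p)))

/-- The idempotent at the vertex `s`, and zero for `n ≤ s`. -/
noncomputable def idem (K : Type*) [Field K] (n : ℕ) [NeZero n] (p : K[X]) (s : ℕ) :
    DeformedPreprojectiveL K n p :=
  if h : s < n then ofPath K n p (PathAlgebra.vertex K LArrow.source LArrow.target ⟨s, h⟩) else 0

/-- The arrow `a_i`, and zero for `n - 1 ≤ i`. -/
noncomputable def arrowA (K : Type*) [Field K] (n : ℕ) [NeZero n] (p : K[X]) (i : ℕ) :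
    DeformedPreprojectiveL K n p :=
  if h : i < n - 1 then ofPath K n p (LPathAlgebra.a K n ⟨i, h⟩) else 0

/-- The arrow `ā_i`, and zero for `n - 1 ≤ i`. -/
noncomputable def arrowAbar (K : Type*) [Field K] (n : ℕ) [NeZero n] (p : K[X]) (i : ℕ) :
    DeformedPreprojectiveL K n p :=
  if h : i < n - 1 then ofPath K n p (LPathAlgebra.abar K n ⟨i, h⟩) else 0

/-- The loop `ε`. -/
noncomputable def loop (K : Type*) [Field K] (n : ℕ) [NeZero n] (p : K[X]) :
    DeformedPreprojectiveL K n p :=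
  ofPath K n p (LPathAlgebra.eps K n)

/-- The sum of the arrows `a_i`. -/
noncomputable def sumA (K : Type*) [Field K] (n : ℕ) [NeZero n] (p : K[X]) :
    DeformedPreprojectiveL K n p :=
  ∑ i ∈ Finset.range (n - 1), arrowA K n p i

/-- The sum of the arrows `ā_i`. -/
noncomputable def sumAbar (K : Type*) [Field K] (n : ℕ) [NeZero n] (p : K[X]) :
    DeformedPreprojectiveL K n p :=
  ∑ i ∈ Finset.range (n - 1), arrowAbar K n p i

theorem idem_of_lt {s : ℕ} (h : s < n) : idem K n p s =
    ofPath K n p (PathAlgebra.vertex K LArrow.source LArrow.target ⟨s, h⟩) := dif_pos h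

theorem idem_of_le {s : ℕ} (h : n ≤ s) : idem K n p s = 0 := dif_neg (not_lt.2 h)

theorem idem_mul_self (s : ℕ) : idem K n p s * idem K n p s = idem K n p s := by
  rcases lt_or_ge s n with h | h
  · rw [idem_of_lt h, ← map_mul, PathAlgebra.vertex_mul_self]
  · rw [idem_of_le h, zero_mul]

theorem idem_mul_idem {s t : ℕ} (hst : s ≠ t) : idem K n p s * idem K n p t = 0 := by
  rcases lt_or_ge s n with h | h
  · rcases lt_or_ge t n with h' | h'
    · rw [idem_of_lt h, idem_of_lt h', ← map_mul, PathAlgebra.vertex_mul_vertex, map_zero]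
      simpa using hst
    · rw [idem_of_le h', mul_zero]
  · rw [idem_of_le h, zero_mul]

theorem sum_idem : ∑ s ∈ Finset.range n, idem K n p s = 1 := by
  rw [Finset.sum_range, ← map_one (ofPath K n p), ← PathAlgebra.sum_vertex, map_sum]
  exact Finset.sum_congr rfl fun s _ => idem_of_lt s.2

theorem arrowA_of_lt {i : ℕ} (h : i < n - 1) :
    arrowA K n p i = ofPath K n p (LPathAlgebra.a K n ⟨i, h⟩) := dif_pos h

theorem arrowAbar_of_lt {i : ℕ} (h : i < n - 1) :
    arrowAbar K n p i = ofPath K n p (LPathAlgebra.abar K n ⟨i, h⟩) := dif_pos h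

theorem idem_mul_arrowA (i : ℕ) : idem K n p i * arrowA K n p i = arrowA K n p i := by
  by_cases h : i < n - 1
  · rw [arrowA_of_lt h, idem_of_lt (by omega), ← map_mul]
    exact congrArg _ (PathAlgebra.vertex_mul_arrow (LArrow.a ⟨i, h⟩))
  · rw [arrowA, dif_neg h, mul_zero]

theorem arrowA_mul_idem (i : ℕ) : arrowA K n p i * idem K n p (i + 1) = arrowA K n p i := by
  by_cases h : i < n - 1
  · rw [arrowA_of_lt h, idem_of_lt (by omega), ← map_mul]
    exact congrArg _ (PathAlgebra.arrow_mul_vertex (LArrow.a ⟨i, h⟩))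
  · rw [arrowA, dif_neg h, zero_mul]

theorem idem_mul_arrowAbar (i : ℕ) :
    idem K n p (i + 1) * arrowAbar K n p i = arrowAbar K n p i := by
  by_cases h : i < n - 1
  · rw [arrowAbar_of_lt h, idem_of_lt (by omega), ← map_mul]
    exact congrArg _ (PathAlgebra.vertex_mul_arrow (LArrow.abar ⟨i, h⟩))
  · rw [arrowAbar, dif_neg h, mul_zero]

theorem arrowAbar_mul_idem (i : ℕ) :
    arrowAbar K n p i * idem K n p i = arrowAbar K n p i := by
  by_cases h : i < n - 1
  · rw [arrowAbar_of_lt h, idem_of_lt (by omega), ← map_mul]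
    exact congrArg _ (PathAlgebra.arrow_mul_vertex (LArrow.abar ⟨i, h⟩))
  · rw [arrowAbar, dif_neg h, zero_mul]

theorem idem_zero_mul_loop : idem K n p 0 * loop K n p = loop K n p := by
  rw [loop, idem_of_lt (NeZero.pos n), ← map_mul]
  exact congrArg _ (PathAlgebra.vertex_mul_arrow LArrow.eps)

theorem loop_mul_idem_zero : loop K n p * idem K n p 0 = loop K n p := by
  rw [loop, idem_of_lt (NeZero.pos n), ← map_mul]
  exact congrArg _ (PathAlgebra.arrow_mul_vertex LArrow.eps)

theorem idem_mul_arrowA_of_ne {s i : ℕ} (h : s ≠ i) : idem K n p s * arrowA K n p i = 0 := by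
  rw [← idem_mul_arrowA, ← mul_assoc, idem_mul_idem h, zero_mul]

theorem arrowA_mul_idem_of_ne {s i : ℕ} (h : i + 1 ≠ s) : arrowA K n p i * idem K n p s = 0 := by
  rw [← arrowA_mul_idem, mul_assoc, idem_mul_idem h, mul_zero]

theorem idem_mul_arrowAbar_of_ne {s i : ℕ} (h : s ≠ i + 1) :
    idem K n p s * arrowAbar K n p i = 0 := by
  rw [← idem_mul_arrowAbar, ← mul_assoc, idem_mul_idem h, zero_mul]

theorem arrowAbar_mul_idem_of_ne {s i : ℕ} (h : i ≠ s) :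
    arrowAbar K n p i * idem K n p s = 0 := by
  rw [← arrowAbar_mul_idem, mul_assoc, idem_mul_idem h, mul_zero]

theorem sumA_mul_sumAbar : sumA K n p * sumAbar K n p =
    ∑ i ∈ Finset.range (n - 1), arrowA K n p i * arrowAbar K n p i := by
  rw [sumA, sumAbar, Finset.sum_mul_sum]
  refine Finset.sum_congr rfl fun i hi => Finset.sum_eq_single_of_mem i hi fun t _ ht => ?_
  rw [← arrowA_mul_idem, mul_assoc, idem_mul_arrowAbar_of_ne (by omega), mul_zero]

theorem sumAbar_mul_sumA : sumAbar K n p * sumA K n p =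
    ∑ i ∈ Finset.range (n - 1), arrowAbar K n p i * arrowA K n p i := by
  rw [sumA, sumAbar, Finset.sum_mul_sum]
  refine Finset.sum_congr rfl fun i hi => Finset.sum_eq_single_of_mem i hi fun t _ ht => ?_
  rw [← arrowAbar_mul_idem, mul_assoc, idem_mul_arrowA_of_ne ht.symm, mul_zero]

theorem idem_mul_sumA {s : ℕ} (hs : s < n - 1) : idem K n p s * sumA K n p = arrowA K n p s := by
  rw [sumA, Finset.mul_sum, Finset.sum_eq_single_of_mem s (Finset.mem_range.2 hs),
    idem_mul_arrowA]
  exact fun t _ ht => idem_mul_arrowA_of_ne ht.symm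

theorem idem_mul_sumAbar {s : ℕ} (hs : s < n - 1) :
    idem K n p (s + 1) * sumAbar K n p = arrowAbar K n p s := by
  rw [sumAbar, Finset.mul_sum, Finset.sum_eq_single_of_mem s (Finset.mem_range.2 hs),
    idem_mul_arrowAbar]
  exact fun t _ ht => idem_mul_arrowAbar_of_ne (by omega)

/-- The mesh relations cancel everything away from the vertex 0, leaving a₀ā₀, which is the deformed
square of the loop. For n = 1 the sums are empty and the right side vanishes by `deformed_one`. -/
theorem sum_add_sum [CharP K 2] : sumA K n p * sumAbar K n p + sumAbar K n p * sumA K n p =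
    aeval (loop K n p) (X ^ 2 + X ^ 3 * p) := by
  have hq : aeval (loop K n p) (X ^ 2 + X ^ 3 * p) = ofPath K n p
      (LPathAlgebra.eps K n ^ 2 + LPathAlgebra.eps K n ^ 3 * aeval (LPathAlgebra.eps K n) p) := by
    simp only [map_add, map_mul, map_pow, aeval_X, loop, aeval_algHom_apply]
  rw [sumA_mul_sumAbar, sumAbar_mul_sumA, hq]
  rcases Nat.lt_or_ge 1 n with hn | hn
  · rw [sum_range_add_sum_range_of_telescoping (by omega)]
    · rw [arrowA_of_lt (by omega), arrowAbar_of_lt (by omega), ← map_mul]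
      have h := ofPath_rel (DeformedRel.deformed (K := K) (p := p) hn)
      rw [add_right_comm, map_add] at h
      rw [eq_neg_of_add_eq_zero_right h]
      exact neg_eq_of_add_eq_zero_left (add_self_eq_zero_of_charTwo K _)
    · intro i hi
      rw [arrowA_of_lt hi, arrowAbar_of_lt hi, arrowA_of_lt (by omega), arrowAbar_of_lt (by omega),
        ← map_mul, ← map_mul, ← map_add]
      exact ofPath_rel (DeformedRel.mesh i hi)
    · rw [arrowA_of_lt (by omega), arrowAbar_of_lt (by omega), ← map_mul]
      exact ofPath_rel (DeformedRel.last hn)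
  · have h1 : n = 1 := le_antisymm hn (NeZero.pos n)
    rw [ofPath_rel (DeformedRel.deformed_one h1), Nat.sub_eq_zero_of_le hn]
    simp

theorem lRelations [CharP K 2] : LRelations K n (X ^ 2 + X ^ 3 * p) (idem K n p) (sumA K n p)
    (sumAbar K n p) (loop K n p) where
  idem := idem_mul_self
  orth _ _ := idem_mul_idem
  e_eq_zero _ := idem_of_le
  sum_e := sum_idem
  e_mul_a s := by
    rw [sumA, Finset.mul_sum, Finset.sum_mul]
    refine Finset.sum_congr rfl fun i _ => ?_
    rcases eq_or_ne s i with rfl | h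
    · rw [idem_mul_arrowA, arrowA_mul_idem]
    · rw [idem_mul_arrowA_of_ne h, arrowA_mul_idem_of_ne (by omega)]
  a_mul_e_zero := by
    rw [sumA, Finset.sum_mul]
    exact Finset.sum_eq_zero fun i _ => arrowA_mul_idem_of_ne i.succ_ne_zero
  e_succ_mul_b s := by
    rw [sumAbar, Finset.mul_sum, Finset.sum_mul]
    refine Finset.sum_congr rfl fun i _ => ?_
    rcases eq_or_ne s i with rfl | h
    · rw [idem_mul_arrowAbar, arrowAbar_mul_idem]
    · rw [idem_mul_arrowAbar_of_ne (by omega), arrowAbar_mul_idem_of_ne h.symm]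
  e_zero_mul_b := by
    rw [sumAbar, Finset.mul_sum]
    exact Finset.sum_eq_zero fun i _ => idem_mul_arrowAbar_of_ne i.succ_ne_zero.symm
  e_zero_mul_eps := idem_zero_mul_loop
  eps_mul_e_zero := loop_mul_idem_zero
  a_mul_b := by
    rw [← sum_add_sum, add_left_comm, add_self_eq_zero_of_charTwo K, add_zero]
  eps_pow := by
    rw [loop, ← map_pow]
    exact ofPath_rel DeformedRel.eps_pow
  X_dvd := ⟨X + X ^ 2 * p, by ring⟩

theorem monomialSpan_eq_top [CharP K 2] :
    LRelations.monomialSpan K (idem K n p) (sumA K n p) (sumAbar K n p) (loop K n p) = ⊤ := by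
  refine lRelations.monomialSpan_eq_top (π := (ofPath K n p).comp (PathAlgebra.ofFree K _ _))
    (ofPath_surjective.comp PathAlgebra.ofFree_surjective) ?_
  rintro (v | _ | i | i)
  · exact Or.inl ⟨v, (idem_of_lt v.2).symm⟩
  · exact Or.inr (Or.inr (Or.inr rfl))
  · exact Or.inr (Or.inl ⟨i, by rw [idem_mul_sumA i.2, arrowA_of_lt i.2]; rfl⟩)
  · exact Or.inr (Or.inr (Or.inl ⟨i + 1, by rw [idem_mul_sumAbar i.2, arrowAbar_of_lt i.2]; rfl⟩))

theorem finite [CharP K 2] : Module.Finite K (DeformedPreprojectiveL K n p) := by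
  have := (lRelations (K := K) (n := n) (p := p)).finite_monomialSpan
  rw [monomialSpan_eq_top] at this
  exact Module.Finite.equiv Submodule.topEquiv

/-- The one-dimensional representation concentrated at a vertex. -/
noncomputable def simple (K : Type*) [Field K] (n : ℕ) [NeZero n] (p : K[X]) (s : Fin n) :
    DeformedPreprojectiveL K n p →ₐ[K] K :=
  RingQuot.liftAlgHom K ⟨PathAlgebra.simple K LArrow.source LArrow.target s,
    LPathAlgebra.simple_rel p s⟩

theorem simple_ofPath (s : Fin n) (x : LPathAlgebra K n) :
    simple K n p s (ofPath K n p x) = PathAlgebra.simple K LArrow.source LArrow.target s x :=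
  RingQuot.liftAlgHom_mkAlgHom_apply K _ _ _

theorem simple_loop (s : Fin n) : simple K n p s (loop K n p) = 0 :=
  (simple_ofPath s _).trans (PathAlgebra.simple_arrow s _)

theorem simple_idem (s : Fin n) (t : ℕ) :
    simple K n p s (idem K n p t) = if t = s then 1 else 0 := by
  by_cases h : t < n
  · rw [idem_of_lt h, simple_ofPath, PathAlgebra.simple_vertex]
    simp [Fin.ext_iff]
  · rw [idem_of_le (not_lt.1 h), map_zero, if_neg]
    omega

theorem exists_trace [CharP K 2] (j : ℕ) :
    ∃ χ : DeformedPreprojectiveL K n (X ^ (2 * j)) →ₗ[K] K[X] ⧸ adjoinModPow K j (2 * n),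
      ∀ x, χ (ofPath K n _ x) = LPathAlgebra.modelTrace K n j x :=
  exists_trace_ringQuot (LPathAlgebra.modelTrace K n j) (LPathAlgebra.modelTrace_mul_comm j) _
    (LPathAlgebra.modelTrace_rel j)

/-- The trace of the matrix model. -/
noncomputable def trace (K : Type*) [Field K] [CharP K 2] (n : ℕ) [NeZero n] (j : ℕ) :
    DeformedPreprojectiveL K n (X ^ (2 * j)) →ₗ[K] K[X] ⧸ adjoinModPow K j (2 * n) :=
  (exists_trace j).choose

theorem trace_ofPath [CharP K 2] (j : ℕ) (x : LPathAlgebra K n) :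
    trace K n j (ofPath K n _ x) = LPathAlgebra.modelTrace K n j x :=
  (exists_trace j).choose_spec x

theorem trace_mul_comm [CharP K 2] (j : ℕ) (x y : DeformedPreprojectiveL K n (X ^ (2 * j))) :
    trace K n j (x * y) = trace K n j (y * x) := by
  obtain ⟨x, rfl⟩ := ofPath_surjective x
  obtain ⟨y, rfl⟩ := ofPath_surjective y
  rw [← map_mul, ← map_mul, trace_ofPath, trace_ofPath, LPathAlgebra.modelTrace_mul_comm]

theorem trace_aeval_loop [CharP K 2] (j : ℕ) (f : K[X]) :
    trace K n j (aeval (loop K n _) (X * f)) = (adjoinModPow K j (2 * n)).mkQ (X * f) := by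
  induction f using Polynomial.induction_on' with
  | add f g hf hg => rw [mul_add, map_add, map_add, map_add, hf, hg]
  | monomial k c =>
    have h : X * monomial k c = c • (X : K[X]) ^ (k + 1) := by
      rw [← C_mul_X_pow_eq_monomial, smul_eq_C_mul]; ring
    rw [h, map_smul, map_smul, map_smul, map_pow, aeval_X, loop, ← map_pow, trace_ofPath,
      LPathAlgebra.modelTrace_apply, LPathAlgebra.model_eps_pow _ k.succ_ne_zero,
      Matrix.trace_single_eq_same]

end DeformedPreprojectiveL

/-! ### The dimension of the Külshammer spaces -/

theorem map_eq_zero_of_mem_commutatorSpace {K A Q : Type*} [Field K] [Ring A] [Algebra K A]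
    [AddCommGroup Q] [Module K Q] (t : A →ₗ[K] Q) (ht : ∀ x y, t (x * y) = t (y * x)) {x : A}
    (hx : x ∈ commutatorSpace K A) : t x = 0 := by
  suffices commutatorSpace K A ≤ LinearMap.ker t from this hx
  refine Submodule.span_le.2 ?_
  rintro _ ⟨a, b, rfl⟩
  rw [SetLike.mem_coe, LinearMap.mem_ker, map_sub, ht, sub_self]

theorem commutatorSpace_le_kuelshammerSpace {K A : Type*} [Field K] [CharP K 2] [Ring A]
    [Algebra K A] (i : ℕ) : commutatorSpace K A ≤ kuelshammerSpace K A i := by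
  intro x hx
  change x ^ 2 ^ i ∈ commutatorSpace K A
  induction i with
  | zero => simpa using hx
  | succ i ih => rw [pow_succ, pow_mul]; exact sq_mem_commutatorSpace ih

namespace DeformedPreprojectiveL

open Polynomial

variable {K : Type*} [Field K] {n : ℕ} [NeZero n] {j : ℕ}

theorem simple_eq_zero_of_mem {p : K[X]} (s : Fin n) {x : DeformedPreprojectiveL K n p}
    (hx : x ∈ commutatorSpace K _) : simple K n p s x = 0 :=
  map_eq_zero_of_mem_commutatorSpace (simple K n p s).toLinearMap
    (fun x y => by simp [mul_comm]) hx

theorem simple_aeval_loop {p : K[X]} (s : Fin n) (f : K[X]) :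
    simple K n p s (aeval (loop K n p) (X * f)) = 0 := by
  rw [map_mul, map_mul, aeval_X, simple_loop, zero_mul]

variable [CharP K 2]

/-- Here the two bounds meet: the trace gives necessity, and the commutators q(ε)^k give
sufficiency. -/
theorem aeval_loop_mem_iff (f : K[X]) :
    aeval (loop K n (X ^ (2 * j))) (X * f) ∈
      commutatorSpace K (DeformedPreprojectiveL K n (X ^ (2 * j))) ↔
    X * f ∈ adjoinModPow K j (2 * n) := by
  constructor
  · intro h
    have h1 := map_eq_zero_of_mem_commutatorSpace (trace K n j) (trace_mul_comm j) h
    rw [trace_aeval_loop] at h1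
    exact (Submodule.Quotient.mk_eq_zero _).1 h1
  · intro h
    exact lRelations.aeval_mem_commutatorSpace (adjoinModPow.mem_iff.1 h) (NeZero.ne n)

/-- Modulo `[A, A]`, an element killed by all one-dimensional representations is a polynomial
in the loop without constant term. -/
theorem exists_aeval_loop {p : K[X]} {x : DeformedPreprojectiveL K n p}
    (hx : ∀ s, simple K n p s x = 0) :
    ∃ f : K[X], x - aeval (loop K n p) (X * f) ∈ commutatorSpace K _ := by
  have hR := lRelations (K := K) (n := n) (p := p)
  have hx' : x ∈ LRelations.normalForms K (idem K n p) (loop K n p) :=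
    hR.monomialSpan_le_normalForms (by rw [monomialSpan_eq_top]; trivial)
  obtain ⟨c, f, h⟩ := hR.exists_normalForm hx'
  refine ⟨f, ?_⟩
  have hc : ∀ s ∈ Finset.range n, c s = 0 := by
    intro s hs
    have h1 := simple_eq_zero_of_mem ⟨s, Finset.mem_range.1 hs⟩ h
    rw [map_sub, hx, map_add, simple_aeval_loop, map_sum, add_zero, zero_sub, neg_eq_zero,
      Finset.sum_eq_single_of_mem s hs] at h1
    · simpa [simple_idem] using h1
    · intro t _ ht
      simp [simple_idem, ht]
  rwa [Finset.sum_eq_zero fun s hs => by rw [hc s hs, zero_smul], zero_add] at h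

/-- An algebra map to the field K kills commutators, and K has no nilpotents. -/
theorem simple_eq_zero_of_mem_kuelshammerSpace {p : K[X]} (s : Fin n) {i : ℕ}
    {x : DeformedPreprojectiveL K n p} (hx : x ∈ kuelshammerSpace K _ i) :
    simple K n p s x = 0 := by
  have h := simple_eq_zero_of_mem s (show x ^ 2 ^ i ∈ commutatorSpace K _ from hx)
  rw [map_pow] at h
  exact pow_eq_zero_iff (by positivity) |>.1 h

theorem aeval_loop_mem_kuelshammerSpace_iff (f : K[X]) (i : ℕ) :
    aeval (loop K n (X ^ (2 * j))) (X * f) ∈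
      kuelshammerSpace K (DeformedPreprojectiveL K n (X ^ (2 * j))) i ↔
    (X * f) ^ 2 ^ i ∈ adjoinModPow K j (2 * n) := by
  obtain ⟨k, hk⟩ := Nat.exists_eq_add_one_of_ne_zero (pow_ne_zero i two_ne_zero)
  have h : (X * f) ^ 2 ^ i = X * (f * (X * f) ^ k) := by rw [hk]; ring
  rw [h, ← aeval_loop_mem_iff, ← h, map_pow]
  rfl

/-- The trace alone misses the idempotents, since E_ss has trace 1, which lies in K[u]. On T_i the
simple modules have already excluded them. -/
theorem mem_commutatorSpace_iff {i : ℕ} {x : DeformedPreprojectiveL K n (X ^ (2 * j))}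
    (hx : x ∈ kuelshammerSpace K _ i) :
    trace K n j x = 0 ↔ x ∈ commutatorSpace K _ := by
  refine ⟨fun h => ?_, map_eq_zero_of_mem_commutatorSpace (trace K n j) (trace_mul_comm j)⟩
  obtain ⟨f, hf⟩ := exists_aeval_loop fun s => simple_eq_zero_of_mem_kuelshammerSpace s hx
  have h1 := map_eq_zero_of_mem_commutatorSpace (trace K n j) (trace_mul_comm j) hf
  rw [map_sub, h, zero_sub, neg_eq_zero, trace_aeval_loop] at h1
  have h2 := (aeval_loop_mem_iff f).2 ((Submodule.Quotient.mk_eq_zero _).1 h1)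
  simpa using add_mem hf h2

theorem map_trace_kuelshammerSpace {m i : ℕ}
    (hm : 2 * n ≤ 2 ^ i * (2 * m + 1) + (2 ^ i - 1) * (2 * j + 1))
    (hlt : ∀ k < m, 2 ^ i * (2 * k + 1) + (2 ^ i - 1) * (2 * j + 1) < 2 * n) :
    (kuelshammerSpace K (DeformedPreprojectiveL K n (X ^ (2 * j))) i).map (trace K n j) =
      (adjoinModPow K j (2 * m)).map (adjoinModPow K j (2 * n)).mkQ := by
  ext y
  constructor
  · rintro ⟨x, hx, rfl⟩
    obtain ⟨f, hf⟩ := exists_aeval_loop fun s => simple_eq_zero_of_mem_kuelshammerSpace s hx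
    have h1 := map_eq_zero_of_mem_commutatorSpace (trace K n j) (trace_mul_comm j) hf
    rw [map_sub, sub_eq_zero, trace_aeval_loop] at h1
    rw [h1]
    refine Submodule.mem_map_of_mem ((adjoinModPow.pow_two_pow_mem_iff hm hlt _).1 ?_)
    rw [← aeval_loop_mem_kuelshammerSpace_iff]
    have h2 := sub_mem hx (commutatorSpace_le_kuelshammerSpace i hf)
    rwa [sub_sub_cancel] at h2
  · rintro ⟨f, hf, rfl⟩
    -- Constants belong to K[u], so f may be replaced by f - f(0), which is a multiple of X.
    have hC : ∀ N, C (f.coeff 0) ∈ adjoinModPow K j N := fun N => by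
      simpa using adjoinModPow.aeval_mem (j := j) N (C (f.coeff 0))
    have h1 : X * f.divX = f - C (f.coeff 0) := eq_sub_of_add_eq (X_mul_divX_add f)
    refine ⟨aeval (loop K n _) (X * f.divX), ?_, ?_⟩
    · rw [SetLike.mem_coe, aeval_loop_mem_kuelshammerSpace_iff,
        adjoinModPow.pow_two_pow_mem_iff hm hlt, h1]
      exact sub_mem hf (hC _)
    · rw [trace_aeval_loop, h1, map_sub, sub_eq_self]
      exact (Submodule.Quotient.mk_eq_zero _).2 (hC _)

theorem finrank_kuelshammerSpace {m i : ℕ} (hmn : m ≤ n)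
    (hm : 2 * n ≤ 2 ^ i * (2 * m + 1) + (2 ^ i - 1) * (2 * j + 1))
    (hlt : ∀ k < m, 2 ^ i * (2 * k + 1) + (2 ^ i - 1) * (2 * j + 1) < 2 * n) :
    Module.finrank K (kuelshammerSpace K (DeformedPreprojectiveL K n (X ^ (2 * j))) i) =
      (n - m) + Module.finrank K
        (commutatorSpace K (DeformedPreprojectiveL K n (X ^ (2 * j)))) := by
  have := finite (K := K) (n := n) (p := X ^ (2 * j))
  set T := kuelshammerSpace K (DeformedPreprojectiveL K n (X ^ (2 * j))) i with hT
  have hker : LinearMap.ker ((trace K n j).domRestrict T) =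
      (commutatorSpace K (DeformedPreprojectiveL K n (X ^ (2 * j)))).submoduleOf T := by
    ext x
    exact mem_commutatorSpace_iff x.2
  rw [← LinearMap.finrank_range_add_finrank_ker ((trace K n j).domRestrict T), hker,
    (Submodule.submoduleOfEquivOfLe (commutatorSpace_le_kuelshammerSpace i)).finrank_eq,
    LinearMap.range_domRestrict, map_trace_kuelshammerSpace hm hlt]
  congr 1
  have h := adjoinModPow.finrank_map_mkQ (K := K) (j := j) n (n - m) (by omega)
  rwa [Nat.sub_sub_self hmn] at h

end DeformedPreprojectiveL

theorem mainTheorem2 (K : Type*) [Field K] [PerfectField K] [CharP K 2]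
    (n : ℕ) [NeZero n] (j : ℕ) (hj : j < n) (i : ℕ) :
    Module.Finite K (DeformedPreprojectiveL K n (Polynomial.X ^ (2 * j))) ∧
    (Module.finrank K
        (kuelshammerSpace K (DeformedPreprojectiveL K n (Polynomial.X ^ (2 * j))) i) : ℤ)
      - (Module.finrank K
        (commutatorSpace K (DeformedPreprojectiveL K n (Polynomial.X ^ (2 * j)))) : ℤ)
      = (n : ℤ) - max ⌈(2 * (n : ℚ) - (2 ^ (i + 1) - 2) * (j : ℚ) - (2 ^ (i + 1) - 1))
          / 2 ^ (i + 1)⌉ 0 := by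
  refine ⟨DeformedPreprojectiveL.finite, ?_⟩
  set c := ⌈(2 * (n : ℚ) - (2 ^ (i + 1) - 2) * (j : ℚ) - (2 ^ (i + 1) - 1)) / 2 ^ (i + 1)⌉ with hc
  obtain ⟨m, hm⟩ := Int.eq_ofNat_of_zero_le (le_max_right c 0)
  -- Setting t = 2^i - 1 removes the truncated subtraction before casting to ℚ.
  obtain ⟨t, ht⟩ := Nat.exists_eq_add_of_le' (Nat.one_le_two_pow (n := i))
  have ht' : (2 : ℚ) ^ (i + 1) = 2 * (t + 1) := by
    rw [pow_succ]; exact_mod_cast (by rw [ht, mul_comm])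
  -- Solving the order inequality for k gives the fraction under the ceiling, so m = max(c, 0) is
  -- the threshold needed by `finrank_kuelshammerSpace`.
  have key : ∀ k : ℕ, c ≤ k ↔ 2 * n ≤ 2 ^ i * (2 * k + 1) + (2 ^ i - 1) * (2 * j + 1) := by
    intro k
    rw [hc, Int.ceil_le, div_le_iff₀ (by positivity), ht', ht, Nat.add_sub_cancel, Int.cast_natCast,
      ← Nat.cast_le (α := ℚ)]
    push_cast
    constructor <;> intro h <;> linarith
  have hmin : ∀ k : ℕ, m ≤ k ↔ c ≤ k := by
    intro k
    rw [← Int.ofNat_le (m := m), ← hm, max_le_iff]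
    exact and_iff_left (Int.natCast_nonneg k)
  have hmn : m ≤ n := by
    rw [hmin, key]
    nlinarith [Nat.one_le_two_pow (n := i), Nat.zero_le ((2 ^ i - 1) * (2 * j + 1))]
  rw [DeformedPreprojectiveL.finrank_kuelshammerSpace hmn ((key m).1 ((hmin m).1 le_rfl)), hm]
  · push_cast [Nat.cast_sub hmn]
    ring
  · intro k hk
    rw [← not_le, ← key, ← hmin]
    omega
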